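/- Let $\mathbb K$ be a field of characteristic $p>0$ and let $n\ge 1$. Let $\mathscr V$ be the category of finite-dimensional $\mathbb K$-vector spaces and ${}_{\mathfrak S_n}\mathscr V$ the category of finite-dimensional $\mathbb K$-linear representations of the symmetric group $\mathfrak S_n$. Let $\mathscr A_n$ be the category of $\mathbb K$-linear functors ${}_{\mathfrak S_n}\mathscr V\to\mathscr V$; for $M$ in ${}_{\mathfrak S_n}\mathscr V$ write $\mathbf h_M=\mathrm{Hom}_{\mathfrak S_n}(M,-)\in\mathscr A_n$, and call $\mathbf f\in\mathscr A_n$ coherent if there is an exact sequence $\mathbf h_N\to\mathbf h_M\to\mathbf f\to 0$ for some $M,N$ in ${}_{\mathfrak S_n}\mathscr V$. Let $\Gamma^n\mathscr V$ be the category with the same objects as $\mathscr V$, with morphisms $\mathrm{Hom}_{\Gamma^n\mathscr V}(V,W)=\Gamma^n(\mathrm{Hom}(V,W))=(\mathrm{Hom}(V,W)^{\otimes n})^{\mathfrak S_n}$ and with composition induced by $(g_1\otimes\cdots\otimes g_n)\circ(f_1\otimes\cdots\otimes f_n)=g_1f_1\otimes\cdots\otimes g_nf_n$. Let $\mathscr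 P_n$ be the category of homogeneous strict polynomial functors of degree $n$, that is, of $\mathbb K$-linear functors $\Gamma^n\mathscr V\to\mathscr V$. Let $j^*:\mathscr A_n\to\mathscr P_n$ be precomposition with the functor $\Gamma^n\mathscr V\to{}_{\mathfrak S_n}\mathscr V$, $V\mapsto V^{\otimes n}$, so that $j^*(\mathbf f)(V)=\mathbf f(V^{\otimes n})$. Then $j^*$ has a right adjoint $j_*$ and a left adjoint $j_!$. For every $F$ in $\mathscr P_n$ the functors $j_*(F)$ and $j_!(F)$ are coherent. The unit $\mathrm{Id}_{\mathscr P_n}\to j^*j_!$ and the counit $j^*j_*\to\mathrm{Id}_{\mathscr P_n}$ are isomorphisms; hence $j_*$ and $j_!$ are fully faithful. -/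

import Mathlib

open CategoryTheory
open scoped TensorProduct

universe u

noncomputable section

namespace StrictPoly

/-! ### Tensor powers and divided powers -/

section Multilinear

variable (K : Type u) [Field K] (n : ℕ)

/-- The action of the symmetric group on `X ^ ⊗ n` by permuting the factors:
`σ • (x₁ ⊗ ⋯ ⊗ xₙ) = x_{σ⁻¹ 1} ⊗ ⋯ ⊗ x_{σ⁻¹ n}`. -/
def permRep (X : Type u) [AddCommGroup X] [Module K X] :
    Representation K (Equiv.Perm (Fin n)) (⨂[K] _ : Fin n, X) where
  toFun σ := (PiTensorProduct.reindex K (fun _ : Fin n => X) σ).toLinearMap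
  map_one' := by
    ext x
    simp [Equiv.Perm.one_def]
  map_mul' σ τ := by
    ext x
    simp only [LinearMap.compMultilinearMap_apply, LinearEquiv.coe_coe, Module.End.mul_apply]
    rw [PiTensorProduct.reindex_tprod, PiTensorProduct.reindex_tprod,
      PiTensorProduct.reindex_tprod]
    rfl

lemma permRep_tprod (X : Type u) [AddCommGroup X] [Module K X] (σ : Equiv.Perm (Fin n))
    (x : Fin n → X) :
    permRep K n X σ (PiTensorProduct.tprod K x) =
      PiTensorProduct.tprod K (fun i => x (σ.symm i)) :=
  PiTensorProduct.reindex_tprod σ x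

/-- The divided power `Γⁿ(X) = H⁰(𝔖ₙ, X ^ ⊗ n)`. -/
def divPow (X : Type u) [AddCommGroup X] [Module K X] : Submodule K (⨂[K] _ : Fin n, X) :=
  (permRep K n X).invariants

variable {K n}
variable {A B C D : Type u} [AddCommGroup A] [Module K A] [AddCommGroup B] [Module K B]
  [AddCommGroup C] [Module K C] [AddCommGroup D] [Module K D]

/-- The linear map `A ^ ⊗ n → B ^ ⊗ n → C ^ ⊗ n` with
`(a₁ ⊗ ⋯ ⊗ aₙ, b₁ ⊗ ⋯ ⊗ bₙ) ↦ f(a₁, b₁) ⊗ ⋯ ⊗ f(aₙ, bₙ)`, that is, the reordering of the factors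
`A ^ ⊗ n ⊗ B ^ ⊗ n → (A ⊗ B) ^ ⊗ n` followed by the `n`-th tensor power of `A ⊗ B → C`. -/
def tensorMap₂ (n : ℕ) (f : A →ₗ[K] B →ₗ[K] C) :
    (⨂[K] _ : Fin n, A) →ₗ[K] (⨂[K] _ : Fin n, B) →ₗ[K] (⨂[K] _ : Fin n, C) :=
  PiTensorProduct.map₂ (fun _ => f)

lemma tensorMap₂_tprod (f : A →ₗ[K] B →ₗ[K] C) (a : Fin n → A) (b : Fin n → B) :
    tensorMap₂ n f (PiTensorProduct.tprod K a) (PiTensorProduct.tprod K b) =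
      PiTensorProduct.tprod K (fun i => f (a i) (b i)) :=
  PiTensorProduct.map₂_tprod_tprod _ _ _

lemma permRep_tensorMap₂ (f : A →ₗ[K] B →ₗ[K] C) (σ : Equiv.Perm (Fin n))
    (s : ⨂[K] _ : Fin n, A) (t : ⨂[K] _ : Fin n, B) :
    permRep K n C σ (tensorMap₂ n f s t) =
      tensorMap₂ n f (permRep K n A σ s) (permRep K n B σ t) := by
  induction s using PiTensorProduct.induction_on with
  | add s s' hs hs' => simp only [map_add, LinearMap.add_apply, hs, hs']
  | smul_tprod r a =>
    induction t using PiTensorProduct.induction_on with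
    | add t t' ht ht' => simp only [map_add, ht, ht']
    | smul_tprod r' b =>
      simp only [map_smul, LinearMap.smul_apply, tensorMap₂_tprod, permRep_tprod]

lemma tensorMap₂_mem (f : A →ₗ[K] B →ₗ[K] C) {s : ⨂[K] _ : Fin n, A} {t : ⨂[K] _ : Fin n, B}
    (hs : s ∈ divPow K n A) (ht : t ∈ divPow K n B) : tensorMap₂ n f s t ∈ divPow K n C :=
  fun σ => by rw [permRep_tensorMap₂, hs σ, ht σ]

variable (K A B C) in
/-- The bilinear composition map `(g, f) ↦ g ∘ f`. -/
def compMap : (B →ₗ[K] C) →ₗ[K] (A →ₗ[K] B) →ₗ[K] (A →ₗ[K] C) :=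
  LinearMap.llcomp K A B C

/-- Composition `Γⁿ(Hom(B, C)) × Γⁿ(Hom(A, B)) → Γⁿ(Hom(A, C))`. -/
def gammaComp (t : divPow K n (B →ₗ[K] C)) (s : divPow K n (A →ₗ[K] B)) :
    divPow K n (A →ₗ[K] C) :=
  ⟨tensorMap₂ n (compMap K A B C) t s, tensorMap₂_mem _ t.2 s.2⟩

/-- The element `γ(x) = x ⊗ ⋯ ⊗ x` of `Γⁿ(X)`. -/
def gammaPow (n : ℕ) (x : A) : divPow K n A :=
  ⟨PiTensorProduct.tprod K (fun _ => x), fun σ => permRep_tprod K n A σ _⟩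

lemma gammaComp_id (t : divPow K n (A →ₗ[K] B)) :
    gammaComp t (gammaPow n LinearMap.id) = t := by
  obtain ⟨t, ht⟩ := t
  apply Subtype.ext
  change tensorMap₂ n (compMap K A A B) t (PiTensorProduct.tprod K _) = t
  clear ht
  induction t using PiTensorProduct.induction_on with
  | add s s' hs hs' => simp only [map_add, LinearMap.add_apply, hs, hs']
  | smul_tprod r a =>
    simp only [map_smul, LinearMap.smul_apply, tensorMap₂_tprod]
    rfl

lemma id_gammaComp (t : divPow K n (A →ₗ[K] B)) :
    gammaComp (gammaPow n LinearMap.id) t = t := by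
  obtain ⟨t, ht⟩ := t
  apply Subtype.ext
  change tensorMap₂ n (compMap K A B B) (PiTensorProduct.tprod K _) t = t
  clear ht
  induction t using PiTensorProduct.induction_on with
  | add s s' hs hs' => simp only [map_add, hs, hs']
  | smul_tprod r a =>
    simp only [map_smul, tensorMap₂_tprod]
    rfl

lemma gammaComp_assoc (r : divPow K n (C →ₗ[K] D)) (s : divPow K n (B →ₗ[K] C))
    (t : divPow K n (A →ₗ[K] B)) :
    gammaComp r (gammaComp s t) = gammaComp (gammaComp r s) t := by
  obtain ⟨r, hr⟩ := r
  obtain ⟨s, hs⟩ := s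
  obtain ⟨t, ht⟩ := t
  apply Subtype.ext
  change tensorMap₂ n (compMap K A C D) r (tensorMap₂ n (compMap K A B C) s t) =
    tensorMap₂ n (compMap K A B D) (tensorMap₂ n (compMap K B C D) r s) t
  clear hr hs ht
  induction r using PiTensorProduct.induction_on with
  | add x y hx hy => simp only [map_add, LinearMap.add_apply, hx, hy]
  | smul_tprod k a =>
    induction s using PiTensorProduct.induction_on with
    | add x y hx hy => simp only [map_add, LinearMap.add_apply, hx, hy]
    | smul_tprod l b =>
      induction t using PiTensorProduct.induction_on with
      | add x y hx hy => simp only [map_add, hx, hy]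
      | smul_tprod m c =>
        simp only [map_smul, LinearMap.smul_apply, tensorMap₂_tprod]
        rfl

/-- The natural map `Γⁿ(Hom(A, B)) → Hom(A ^ ⊗ n, B ^ ⊗ n)`. -/
def gammaAct (t : divPow K n (A →ₗ[K] B)) : (⨂[K] _ : Fin n, A) →ₗ[K] (⨂[K] _ : Fin n, B) :=
  PiTensorProduct.piTensorHomMap (t : ⨂[K] _ : Fin n, (A →ₗ[K] B))

lemma permRep_piTensorHomMap (σ : Equiv.Perm (Fin n)) (t : ⨂[K] _ : Fin n, (A →ₗ[K] B))
    (x : ⨂[K] _ : Fin n, A) :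
    permRep K n B σ (PiTensorProduct.piTensorHomMap t x) =
      PiTensorProduct.piTensorHomMap (permRep K n (A →ₗ[K] B) σ t) (permRep K n A σ x) := by
  induction t using PiTensorProduct.induction_on with
  | add s s' hs hs' => simp only [map_add, LinearMap.add_apply, hs, hs']
  | smul_tprod r f =>
    induction x using PiTensorProduct.induction_on with
    | add y y' hy hy' => simp only [map_add, hy, hy']
    | smul_tprod l a =>
      simp only [map_smul, LinearMap.smul_apply, permRep_tprod,
        PiTensorProduct.piTensorHomMap_tprod_tprod]

lemma gammaAct_permRep (t : divPow K n (A →ₗ[K] B)) (σ : Equiv.Perm (Fin n)) :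
    gammaAct t ∘ₗ permRep K n A σ = permRep K n B σ ∘ₗ gammaAct t := by
  refine LinearMap.ext fun x => ?_
  change PiTensorProduct.piTensorHomMap t.1 (permRep K n A σ x) =
    permRep K n B σ (PiTensorProduct.piTensorHomMap t.1 x)
  rw [permRep_piTensorHomMap, t.2 σ]

lemma gammaAct_id : gammaAct (gammaPow n (LinearMap.id : A →ₗ[K] A)) = LinearMap.id := by
  change PiTensorProduct.piTensorHomMap (PiTensorProduct.tprod K _) = _
  rw [PiTensorProduct.piTensorHomMap_tprod_eq_map]
  exact PiTensorProduct.map_id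

lemma gammaAct_comp (t : divPow K n (B →ₗ[K] C)) (s : divPow K n (A →ₗ[K] B)) :
    gammaAct (gammaComp t s) = gammaAct t ∘ₗ gammaAct s := by
  obtain ⟨t, ht⟩ := t
  obtain ⟨s, hs⟩ := s
  change PiTensorProduct.piTensorHomMap (tensorMap₂ n (compMap K A B C) t s) =
    PiTensorProduct.piTensorHomMap t ∘ₗ PiTensorProduct.piTensorHomMap s
  clear ht hs
  induction t using PiTensorProduct.induction_on with
  | add x y hx hy => simp only [map_add, LinearMap.add_apply, LinearMap.add_comp, hx, hy]
  | smul_tprod k a =>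
    induction s using PiTensorProduct.induction_on with
    | add x y hx hy => simp only [map_add, LinearMap.comp_add, hx, hy]
    | smul_tprod l b =>
      simp only [map_smul, LinearMap.smul_apply, tensorMap₂_tprod, LinearMap.smul_comp,
        LinearMap.comp_smul]
      congr 2
      refine PiTensorProduct.ext (MultilinearMap.ext fun x => ?_)
      simp only [LinearMap.compMultilinearMap_apply, LinearMap.comp_apply,
        PiTensorProduct.piTensorHomMap_tprod_tprod]
      rfl

end Multilinear

/-! ### The category `Γⁿ𝒱` and strict polynomial functors -/

section Categories

/-- The category `Γⁿ𝒱`: its objects are the finite-dimensional vector spaces over `K`. -/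
structure GammaCat (K : Type u) [Field K] (n : ℕ) : Type (u + 1) where
  /-- the underlying finite-dimensional vector space -/
  space : FGModuleCat.{u} K

variable (K : Type u) [Field K] (n : ℕ)

/-- Morphisms `V ⟶ W` in `Γⁿ𝒱` are the elements of `Γⁿ(Hom(V, W))`. -/
instance : Category.{u} (GammaCat K n) where
  Hom V W := divPow K n (V.space →ₗ[K] W.space)
  id _ := gammaPow n LinearMap.id
  comp s t := gammaComp t s
  id_comp t := gammaComp_id t
  comp_id t := id_gammaComp t
  assoc r s t := gammaComp_assoc t s r

instance : Preadditive (GammaCat K n) where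
  homGroup V W := inferInstanceAs (AddCommGroup (divPow K n (V.space →ₗ[K] W.space)))
  add_comp U V W s s' t := Subtype.ext
    (map_add (tensorMap₂ n (compMap K U.space V.space W.space) t.1) s.1 s'.1)
  comp_add U V W s t t' := Subtype.ext (by
    change tensorMap₂ n (compMap K U.space V.space W.space) (t.1 + t'.1) s.1 =
      tensorMap₂ n (compMap K U.space V.space W.space) t.1 s.1 +
        tensorMap₂ n (compMap K U.space V.space W.space) t'.1 s.1
    rw [map_add, LinearMap.add_apply])

instance : Linear K (GammaCat K n) where
  homModule V W := inferInstanceAs (Module K (divPow K n (V.space →ₗ[K] W.space)))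
  smul_comp U V W r s t := Subtype.ext
    (map_smul (tensorMap₂ n (compMap K U.space V.space W.space) t.1) r s.1)
  comp_smul U V W s r t := Subtype.ext (by
    change tensorMap₂ n (compMap K U.space V.space W.space) (r • t.1) s.1 =
      r • tensorMap₂ n (compMap K U.space V.space W.space) t.1 s.1
    rw [map_smul, LinearMap.smul_apply])

/-- The representation `V ^ ⊗ n` of the symmetric group. -/
def tensorPowRep (V : FGModuleCat.{u} K) : FDRep K (Equiv.Perm (Fin n)) :=
  FDRep.of (permRep K n V)

/-- The functor `i : Γⁿ𝒱 ⥤ {finite-dimensional representations of 𝔖ₙ}`, `V ↦ V ^ ⊗ n`. -/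
def iFunctor : GammaCat K n ⥤ FDRep K (Equiv.Perm (Fin n)) where
  obj V := tensorPowRep K n V.space
  map t :=
    { hom := FGModuleCat.ofHom (gammaAct t)
      comm := fun σ => FGModuleCat.hom_ext (gammaAct_permRep t σ) }
  map_id _ := Action.Hom.ext (FGModuleCat.hom_ext gammaAct_id)
  map_comp s t := Action.Hom.ext (FGModuleCat.hom_ext (gammaAct_comp t s))

instance : (iFunctor K n).Additive where
  map_add {_ _ s t} := Action.Hom.ext (FGModuleCat.hom_ext
    (map_add PiTensorProduct.piTensorHomMap s.1 t.1))

instance : (iFunctor K n).Linear K where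
  map_smul t r := Action.Hom.ext (FGModuleCat.hom_ext
    (map_smul PiTensorProduct.piTensorHomMap r t.1))

/-- The property of a functor to be `K`-linear. -/
def isLinear (C : Type*) [Category* C] [Preadditive C] [Linear K C] (D : Type*) [Category* D]
    [Preadditive D] [Linear K D] : ObjectProperty (C ⥤ D) :=
  fun F => F.Additive ∧ F.Linear K

/-- The category `𝒫ₙ` of homogeneous strict polynomial functors of degree `n`: the `K`-linear
functors from `Γⁿ𝒱` to finite-dimensional vector spaces. -/
abbrev StrictPolyFunctor := (isLinear K (GammaCat K n) (FGModuleCat.{u} K)).FullSubcategory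

/-- The category `𝒜(G)` of `K`-linear functors from finite-dimensional `G`-modules to
finite-dimensional vector spaces. -/
abbrev RepFunctor (G : Type) [Group G] :=
  (isLinear K (FDRep K G) (FGModuleCat.{u} K)).FullSubcategory

variable {K} in
/-- The representable functor `h_M = Hom_G(M, -)`. -/
def hFunctor {G : Type} [Group G] (M : FDRep K G) : RepFunctor K G where
  obj :=
    { obj := fun X => FGModuleCat.of K (M ⟶ X)
      map := fun f => FGModuleCat.ofHom (Linear.rightComp K M f)
      map_id := fun _ => FGModuleCat.hom_ext (LinearMap.ext fun g => Category.comp_id g)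
      map_comp := fun f f' => FGModuleCat.hom_ext
        (LinearMap.ext fun g => (Category.assoc g f f').symm) }
  property :=
    ⟨{ map_add := FGModuleCat.hom_ext (LinearMap.ext fun g => Preadditive.comp_add _ _ _ g _ _) },
     { map_smul := fun f r =>
        FGModuleCat.hom_ext (LinearMap.ext fun g => Linear.comp_smul _ _ _ g r f) }⟩

/-- A functor `f` in `𝒜(G)` is coherent if there is an exact sequence `h_N ⟶ h_M ⟶ f ⟶ 0`
in `𝒜(G)`; exactness of sequences of functors is exactness at every object. -/
def IsCoherent {G : Type} [Group G] (f : RepFunctor K G) : Prop :=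
  ∃ (M N : FDRep K G) (a : hFunctor N ⟶ hFunctor M) (π : hFunctor M ⟶ f),
    ∀ X : FDRep K G,
      Function.Exact (a.hom.app X).hom.hom (π.hom.app X).hom.hom ∧
        Function.Surjective (π.hom.app X).hom.hom

/-- The functor `j^* : 𝒜(𝔖ₙ) ⥤ 𝒫ₙ`, `j^*(f)(V) = f(V ^ ⊗ n)`, i.e. precomposition with `i`. -/
def jStar : RepFunctor K (Equiv.Perm (Fin n)) ⥤ StrictPolyFunctor K n where
  obj f := ⟨iFunctor K n ⋙ f.obj, by
    obtain ⟨F, hF₁, hF₂⟩ := f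
    exact ⟨inferInstance, inferInstance⟩⟩
  map φ := ObjectProperty.homMk (Functor.whiskerLeft (iFunctor K n) φ.hom)

end Categories

end StrictPoly

end

/-! The functor `iFunctor`, V ↦ V^{⊗n}, is fully faithful. Indeed Hom(A, B)^{⊗n} → Hom(A^{⊗n},
B^{⊗n}) is bijective (`piTensorHomMap_bijective`), and it matches invariant tensors with equivariant
maps. Moreover the single object W = K^n generates Γⁿ𝒱 (`isGenerator_stdObj`): every identity is a
sum of morphisms that factor through W. Hence a strict polynomial functor F is determined by the
module F(W) over the Schur algebra S = End(W), and both adjoints of restriction along i have closed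
formulas: j_*(F)(X) = Hom_S(Hom(X, iW), F(W)) and j_!(F)(X) = Hom(iW, X) ⊗_S F(W), the latter
written as a cokernel by means of a finite presentation of F.

For X = iV full faithfulness turns Hom(iV, iW) into Hom(V, W), and the generator property identifies
both formulas with F(V) (`coindUnit_bijective`, `isIso_indCounit`). These comparison isomorphisms
are, up to inversion, the counit and the unit.

Coherence of j_!(F) is read off from the presentation, with direct sums of copies of iW as
representing objects. For j_*(F), the space Hom_S(Hom(X, iW), F(W)) is the kernel of a map between
functors of the form X ↦ Hom(Hom_G(X, M), N), and kernels of maps of coherent functors are coherent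
(`IsCoherent.of_kernel`). Such functors are coherent for a finite group G
(`isCoherent_dualHFunctor`): by the trace pairing the dual of Hom_G(X, M) is the space of
G-coinvariants of Hom_K(M, X), and Hom_K(U, X) = Hom_G(Ind U, X) is representable. None of this
divides by n!, so small characteristic causes no trouble. -/

noncomputable section

namespace StrictPoly

/-! ### Elementwise description of linear functors -/

section Elementwise

universe v w

variable {K : Type u} [Field K] {C : Type w} [Category.{v} C] [Preadditive C] [Linear K C]

variable (K C) in
/-- The category of `K`-linear functors from `C` to finite-dimensional vector spaces. -/
abbrev LinFun := (isLinear K C (FGModuleCat.{u} K)).FullSubcategory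

/-- The action of morphisms on the values of a linear functor. -/
def act (F : LinFun K C) {X Y : C} : (X ⟶ Y) →ₗ[K] (F.obj.obj X →ₗ[K] F.obj.obj Y) where
  toFun g := (F.obj.map g).hom.hom
  map_add' g g' := by
    have := F.property.1
    rw [F.obj.map_add]
    rfl
  map_smul' r g := by
    have := F.property.1
    have := F.property.2
    rw [F.obj.map_smul]
    rfl

lemma act_id (F : LinFun K C) (X : C) (x : F.obj.obj X) : act F (𝟙 X) x = x := by
  change (F.obj.map (𝟙 X)).hom.hom x = x
  rw [F.obj.map_id]
  rfl

lemma act_comp (F : LinFun K C) {X Y Z : C} (f : X ⟶ Y) (g : Y ⟶ Z) (x : F.obj.obj X) :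
    act F (f ≫ g) x = act F g (act F f x) := by
  change (F.obj.map (f ≫ g)).hom.hom x = _
  rw [F.obj.map_comp]
  rfl

lemma act_sum {ι : Type*} (s : Finset ι) (F : LinFun K C) {X Y : C} (g : ι → (X ⟶ Y))
    (x : F.obj.obj X) : act F (∑ i ∈ s, g i) x = ∑ i ∈ s, act F (g i) x := by
  rw [map_sum, LinearMap.sum_apply]

/-- The components of a morphism of linear functors. -/
def app {F F' : LinFun K C} (φ : F ⟶ F') (X : C) : F.obj.obj X →ₗ[K] F'.obj.obj X :=
  (φ.hom.app X).hom.hom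

lemma app_act {F F' : LinFun K C} (φ : F ⟶ F') {X Y : C} (g : X ⟶ Y) (x : F.obj.obj X) :
    app φ Y (act F g x) = act F' g (app φ X x) :=
  congrArg (fun t : F.obj.obj X ⟶ F'.obj.obj Y => t.hom.hom x) (φ.hom.naturality g)

lemma hom_ext {F F' : LinFun K C} {φ ψ : F ⟶ F'} (h : ∀ X x, app φ X x = app ψ X x) : φ = ψ := by
  apply ObjectProperty.hom_ext
  ext X : 2
  exact FGModuleCat.hom_ext (LinearMap.ext (h X))

lemma app_comp {F F' F'' : LinFun K C} (φ : F ⟶ F') (ψ : F' ⟶ F'') (X : C) (x : F.obj.obj X) :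
    app (φ ≫ ψ) X x = app ψ X (app φ X x) := rfl

/-- A morphism of linear functors from its components. -/
def mkHom {F F' : LinFun K C} (t : ∀ X : C, F.obj.obj X →ₗ[K] F'.obj.obj X)
    (ht : ∀ {X Y : C} (g : X ⟶ Y) (x : F.obj.obj X), t Y (act F g x) = act F' g (t X x)) :
    F ⟶ F' :=
  ObjectProperty.homMk
    { app := fun X => FGModuleCat.ofHom (t X)
      naturality := fun _ _ g => FGModuleCat.hom_ext (LinearMap.ext (ht g)) }

/-- A linear functor from its values and its action. -/
def mkLinFun (M : C → Type u) [∀ X, AddCommGroup (M X)] [∀ X, Module K (M X)]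
    [∀ X, Module.Finite K (M X)] (m : ∀ {X Y : C}, (X ⟶ Y) →ₗ[K] (M X →ₗ[K] M Y))
    (hid : ∀ X x, m (𝟙 X) x = x)
    (hcomp : ∀ {X Y Z : C} (f : X ⟶ Y) (g : Y ⟶ Z) (x : M X), m (f ≫ g) x = m g (m f x)) :
    LinFun K C where
  obj :=
    { obj := fun X => FGModuleCat.of K (M X)
      map := fun g => FGModuleCat.ofHom (m g)
      map_id := fun X => FGModuleCat.hom_ext (LinearMap.ext (hid X))
      map_comp := fun f g => FGModuleCat.hom_ext (LinearMap.ext (hcomp f g)) }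
  property :=
    ⟨{ map_add := FGModuleCat.hom_ext (map_add m _ _) },
     { map_smul := fun f r => FGModuleCat.hom_ext (map_smul m r f) }⟩

end Elementwise

/-! ### Coherent functors -/

section Coherent

variable {K : Type u} [Field K] {G : Type} [Group G]

/-- Yoneda: the two maps in a presentation correspond to a morphism `v` and an element `x`, the
images of identities. Coherence becomes generation by one element whose annihilator consists of the
morphisms that factor through `v`. -/
lemma isCoherent_iff (f : RepFunctor K G) :
    IsCoherent K f ↔ ∃ (M N : FDRep K G) (v : M ⟶ N) (x : f.obj.obj M),
      (∀ X (y : f.obj.obj X), ∃ g : M ⟶ X, act f g x = y) ∧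
        ∀ X (g : M ⟶ X), act f g x = 0 ↔ ∃ h : N ⟶ X, v ≫ h = g := by
  constructor
  · rintro ⟨M, N, a, π, h⟩
    have hπ (X : FDRep K G) (g : M ⟶ X) : app π X g = act f g (app π M (𝟙 M)) := by
      have := app_act π g (𝟙 M)
      rw [← this]
      exact congrArg (app π X) (Category.id_comp g).symm
    have ha (X : FDRep K G) (g : N ⟶ X) : app a X g = (app a N (𝟙 N) : M ⟶ N) ≫ g := by
      have := app_act a g (𝟙 N)
      refine Eq.trans ?_ this
      exact congrArg (app a X) (Category.id_comp g).symm
    refine ⟨M, N, app a N (𝟙 N), app π M (𝟙 M), fun X y => ?_, fun X g => ?_⟩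
    · obtain ⟨g, hg⟩ := (h X).2 y
      exact ⟨g, (hπ X g).symm.trans hg⟩
    · rw [← hπ]
      refine ((h X).1 g).trans ?_
      exact exists_congr fun k => iff_of_eq (congrArg (· = g) (ha X k))
  · rintro ⟨M, N, v, x, hgen, hrel⟩
    refine ⟨M, N, mkHom (F := hFunctor N) (F' := hFunctor M) (fun X => Linear.leftComp K X v)
      (fun g k => (Category.assoc v k g).symm),
      mkHom (F := hFunctor M) (F' := f) (fun X => (act f).flip x)
      (fun g k => act_comp f k g x), fun X => ⟨fun g => ?_, fun y => hgen X y⟩⟩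
    exact hrel X g

lemma IsCoherent.of_bijective {f f' : RepFunctor K G} (e : f ⟶ f')
    (he : ∀ X, Function.Bijective (app e X)) (h : IsCoherent K f) : IsCoherent K f' := by
  rw [isCoherent_iff] at h ⊢
  obtain ⟨M, N, v, x, hgen, hrel⟩ := h
  refine ⟨M, N, v, app e M x, fun X y => ?_, fun X g => ?_⟩
  · obtain ⟨y, rfl⟩ := (he X).2 y
    obtain ⟨g, rfl⟩ := hgen X y
    exact ⟨g, (app_act e g x).symm⟩
  · rw [← hrel, ← app_act]
    exact map_eq_zero_iff _ (he X).1

lemma IsCoherent.of_iso {f f' : RepFunctor K G} (e : f ≅ f') (h : IsCoherent K f) :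
    IsCoherent K f' := by
  refine h.of_bijective e.hom fun X => Function.bijective_iff_has_inverse.2
    ⟨app e.inv X, fun y => ?_, fun y => ?_⟩
  · rw [← app_comp, e.hom_inv_id]
    rfl
  · rw [← app_comp, e.inv_hom_id]
    rfl

/-- The kernel of a morphism of coherent functors is coherent. -/
lemma IsCoherent.of_kernel {f f₀ f₁ : RepFunctor K G} (h₀ : IsCoherent K f₀)
    (h₁ : IsCoherent K f₁) (κ : f ⟶ f₀) (φ : f₀ ⟶ f₁)
    (hκ : ∀ X, Function.Injective (app κ X))
    (hex : ∀ X y, app φ X y = 0 ↔ ∃ z, app κ X z = y) : IsCoherent K f := by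
  rw [isCoherent_iff] at h₀ h₁ ⊢
  -- The image of the generator `x` under `φ` is `w` applied to the generator `x'`. So `g` applied
  -- to `x` lies in the kernel of `φ` exactly when `w ≫ g` factors through `v'`, that is, when `g`
  -- extends to the pushout of `w` and `v'`.
  obtain ⟨M, N, v, x, hgen, hrel⟩ := h₀
  obtain ⟨M', N', v', x', hgen', hrel'⟩ := h₁
  obtain ⟨w, hw⟩ := hgen' M (app φ M x)
  have key (X : FDRep K G) (g : M ⟶ X) :
      (∃ z, app κ X z = act f₀ g x) ↔ ∃ h : N' ⟶ X, v' ≫ h = w ≫ g := by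
    rw [← hex, ← hrel', app_act, ← hw, act_comp]
  -- The universal such extension gives the generator `z` of the kernel. A morphism kills `z` when
  -- its restriction to `M` factors through `v`, which is the role of the second pushout.
  obtain ⟨z, hz⟩ := (key _ (Limits.pushout.inl w v')).2
    ⟨Limits.pushout.inr w v', Limits.pushout.condition.symm⟩
  refine ⟨Limits.pushout w v', Limits.pushout (Limits.pushout.inl w v') v,
    Limits.pushout.inl _ _, z, fun X y => ?_, fun X g => ?_⟩
  · obtain ⟨g, hg⟩ := hgen X (app κ X y)
    obtain ⟨h, hh⟩ := (key X g).1 ⟨y, hg.symm⟩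
    refine ⟨Limits.pushout.desc g h hh.symm, hκ X ?_⟩
    rw [app_act, hz, ← act_comp, Limits.pushout.inl_desc, hg]
  · have : act f g z = 0 ↔ ∃ h : N ⟶ X, v ≫ h = Limits.pushout.inl w v' ≫ g := by
      rw [← hrel, act_comp, ← hz, ← app_act]
      exact ⟨fun h => by rw [h, map_zero], fun h => hκ X (by rw [h, map_zero])⟩
    rw [this]
    constructor
    · rintro ⟨h, hh⟩
      exact ⟨Limits.pushout.desc g h hh.symm, Limits.pushout.inl_desc _ _ _⟩
    · rintro ⟨h, rfl⟩
      exact ⟨Limits.pushout.inr _ _ ≫ h, by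
        rw [← Category.assoc, ← Category.assoc, Limits.pushout.condition]⟩

end Coherent

/-! ### Functors dual to representable functors -/

section TracePairing

variable {K : Type u} [Field K] {A B : Type u} [AddCommGroup A] [Module K A] [Module.Finite K A]
  [AddCommGroup B] [Module K B] [Module.Finite K B]

variable (K A B) in
/-- The trace pairing `(θ, φ) ↦ tr (φ ∘ θ)`. -/
def tracePairing : (A →ₗ[K] B) →ₗ[K] (B →ₗ[K] A) →ₗ[K] K :=
  ((LinearMap.llcomp K A B A).flip).compr₂ (LinearMap.trace K A)

omit [Module.Finite K A] [Module.Finite K B] in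
lemma tracePairing_apply (θ : A →ₗ[K] B) (φ : B →ₗ[K] A) :
    tracePairing K A B θ φ = LinearMap.trace K A (φ ∘ₗ θ) := rfl

/-- Testing against the rank one maps b ↦ ξ(b) a gives ξ(θ a) = 0 for all ξ and a. -/
lemma tracePairing_injective : Function.Injective (tracePairing K A B) := by
  rw [injective_iff_map_eq_zero]
  intro θ hθ
  ext a
  rw [LinearMap.zero_apply, ← Module.forall_dual_apply_eq_zero_iff K]
  intro ξ
  have := LinearMap.congr_fun hθ (ξ.smulRight a)
  rw [tracePairing_apply, LinearMap.trace_comp_comm'] at this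
  have h2 : θ ∘ₗ ξ.smulRight a = ξ.smulRight (θ a) := by
    ext b
    simp
  rwa [h2, LinearMap.trace_smulRight] at this

lemma tracePairing_surjective : Function.Surjective (tracePairing K A B) := by
  refine (LinearMap.injective_iff_surjective_of_finrank_eq_finrank ?_).1 tracePairing_injective
  change _ = Module.finrank K (Module.Dual K (B →ₗ[K] A))
  rw [Subspace.dual_finrank_eq, Module.finrank_linearMap, Module.finrank_linearMap, mul_comm]

end TracePairing

section DualRepresentable

variable {K : Type u} [Field K] {G : Type} [Group G]

/-- The linear map underlying a morphism of representations. -/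
def lin {X Y : FDRep K G} : (X ⟶ Y) →ₗ[K] (X →ₗ[K] Y) where
  toFun φ := φ.hom.hom.hom
  map_add' _ _ := rfl
  map_smul' _ _ := rfl

lemma lin_injective {X Y : FDRep K G} : Function.Injective (lin (X := X) (Y := Y)) :=
  fun _ _ h => Action.Hom.ext (FGModuleCat.hom_ext h)

lemma lin_comp {X Y Z : FDRep K G} (φ : X ⟶ Y) (ψ : Y ⟶ Z) : lin (φ ≫ ψ) = lin ψ ∘ₗ lin φ := rfl

lemma lin_rho {X Y : FDRep K G} (φ : X ⟶ Y) (g : G) : lin φ ∘ₗ X.ρ g = Y.ρ g ∘ₗ lin φ :=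
  congrArg (fun t : X.V ⟶ Y.V => t.hom.hom) (φ.comm g)

/-- A morphism of representations from an equivariant linear map. -/
def homOfLin {X Y : FDRep K G} (t : X →ₗ[K] Y) (ht : ∀ g, t ∘ₗ X.ρ g = Y.ρ g ∘ₗ t) : X ⟶ Y :=
  { hom := FGModuleCat.ofHom t
    comm := fun g => FGModuleCat.hom_ext (ht g) }

lemma rho_mul_apply (X : FDRep K G) (g h : G) (x : X) : X.ρ (g * h) x = X.ρ g (X.ρ h x) := by
  rw [map_mul]
  rfl

/-- A functional on the equivariant maps extends to all linear maps, where the trace pairing is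
perfect. -/
lemma exists_tracePairing {X M : FDRep K G} (l : (X ⟶ M) →ₗ[K] K) :
    ∃ θ : M →ₗ[K] X, ∀ φ, l φ = tracePairing K M X θ (lin φ) := by
  obtain ⟨q, hq⟩ := (lin (X := X) (Y := M)).exists_leftInverse_of_injective
    (LinearMap.ker_eq_bot.2 lin_injective)
  obtain ⟨θ, hθ⟩ := tracePairing_surjective (l ∘ₗ q)
  refine ⟨θ, fun φ => ?_⟩
  rw [hθ, LinearMap.comp_apply, ← LinearMap.comp_apply (g := lin), hq, LinearMap.id_apply]

variable [Fintype G]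

/-- The linear maps that pair to zero with the equivariant ones. -/
lemma tracePairing_lin_eq_zero_iff {X M : FDRep K G} (θ : M →ₗ[K] X) :
    (∀ φ : X ⟶ M, tracePairing K M X θ (lin φ) = 0) ↔
      ∃ η : G → (M →ₗ[K] X), θ = ∑ g, (X.ρ g ∘ₗ η g - η g ∘ₗ M.ρ g) := by
  classical
  -- Cyclicity of the trace moves the commutator with the group action from one argument of the
  -- pairing to the other.
  have hswap (φ : X →ₗ[K] M) (η : G → (M →ₗ[K] X)) :
      tracePairing K M X (∑ g, (X.ρ g ∘ₗ η g - η g ∘ₗ M.ρ g)) φ =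
        ∑ g, tracePairing K M X (η g) (φ ∘ₗ X.ρ g - M.ρ g ∘ₗ φ) := by
    rw [map_sum, LinearMap.sum_apply]
    refine Finset.sum_congr rfl fun g _ => ?_
    rw [map_sub, LinearMap.sub_apply, map_sub]
    simp only [tracePairing_apply]
    congr 1
    rw [← LinearMap.comp_assoc, LinearMap.trace_comp_comm', LinearMap.comp_assoc]
  constructor
  · intro h
    -- The equivariant maps are the kernel of `d`. The annihilator of a kernel is the range of the
    -- dual map, and each component of the resulting functional is again a trace pairing, with some
    -- `η g`.
    let d : (X →ₗ[K] M) →ₗ[K] (G → (X →ₗ[K] M)) :=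
      LinearMap.pi fun g => (LinearMap.lcomp K M (X.ρ g)) - LinearMap.llcomp K X M M (M.ρ g)
    have hd (φ : X →ₗ[K] M) (g : G) : d φ g = φ ∘ₗ X.ρ g - M.ρ g ∘ₗ φ := rfl
    have hmem : tracePairing K M X θ ∈ (LinearMap.ker d).dualAnnihilator := by
      rw [Submodule.mem_dualAnnihilator]
      intro φ hφ
      refine h (homOfLin φ fun g => ?_)
      have := congrFun (LinearMap.mem_ker.1 hφ) g
      rw [hd] at this
      exact sub_eq_zero.1 this
    rw [← LinearMap.range_dualMap_eq_dualAnnihilator_ker] at hmem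
    obtain ⟨μ, hμ⟩ := hmem
    choose η hη using fun g =>
      tracePairing_surjective (μ ∘ₗ LinearMap.single K (fun _ : G => X →ₗ[K] M) g)
    refine ⟨η, tracePairing_injective (LinearMap.ext fun φ => ?_)⟩
    rw [hswap, ← hμ, LinearMap.dualMap_apply]
    simp only [hη, LinearMap.comp_apply, ← hd]
    rw [← map_sum]
    congr 1
    exact (Finset.univ_sum_single (d φ)).symm
  · rintro ⟨η, rfl⟩ φ
    rw [hswap]
    refine Finset.sum_eq_zero fun g _ => ?_
    rw [lin_rho, sub_self, map_zero]

variable (K G) in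
/-- The representation of `G` induced from the vector space `U`. -/
def indRep (U : Type u) [AddCommGroup U] [Module K U] [Module.Finite K U] : FDRep K G :=
  FDRep.of (V := G → U)
    { toFun := fun g => LinearMap.funLeft K U fun h => g⁻¹ * h
      map_one' := by
        ext f h
        simp [LinearMap.funLeft_apply]
      map_mul' := fun g g' => by
        refine LinearMap.ext fun f => funext fun h => ?_
        change f ((g * g')⁻¹ * h) = f (g'⁻¹ * (g⁻¹ * h))
        rw [mul_inv_rev, mul_assoc] }

variable {U : Type u} [AddCommGroup U] [Module K U] [Module.Finite K U]

open Classical in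
variable (K G U) in
/-- The inclusion of `U` in the induced representation. -/
def indIncl : U →ₗ[K] indRep K G U := LinearMap.single K (fun _ : G => U) 1

open Classical in
lemma indRep_rho_incl (g : G) (x : U) :
    (indRep K G U).ρ g (indIncl K G U x) = (Pi.single g x : G → U) := by
  change (fun h => (Pi.single 1 x : G → U) (g⁻¹ * h)) = _
  funext h
  by_cases hh : h = g
  · subst hh
    simp
  · rw [Pi.single_eq_of_ne hh, Pi.single_eq_of_ne]
    rwa [ne_eq, inv_mul_eq_one, eq_comm]

/-- The morphism from the induced representation given by a linear map. -/
def indDesc {X : FDRep K G} (θ : U →ₗ[K] X) : indRep K G U ⟶ X :=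
  homOfLin (X := indRep K G U) (∑ h, X.ρ h ∘ₗ θ ∘ₗ LinearMap.proj (R := K) (φ := fun _ : G => U) h)
    fun g => by
      refine LinearMap.ext fun f => ?_
      rw [LinearMap.comp_apply, LinearMap.comp_apply, LinearMap.sum_apply, LinearMap.sum_apply,
        map_sum, ← Equiv.sum_comp (Equiv.mulLeft g)]
      refine Finset.sum_congr rfl fun h _ => ?_
      change X.ρ (g * h) (θ (f (g⁻¹ * (g * h)))) = X.ρ g (X.ρ h (θ (f h)))
      rw [inv_mul_cancel_left, rho_mul_apply]

lemma indDesc_incl {X : FDRep K G} (θ : U →ₗ[K] X) :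
    lin (indDesc (G := G) θ) ∘ₗ indIncl K G U = θ := by
  classical
  refine LinearMap.ext fun x => ?_
  change (∑ h, X.ρ h ∘ₗ θ ∘ₗ LinearMap.proj (R := K) (φ := fun _ : G => U) h)
    (Pi.single 1 x : G → U) = _
  rw [LinearMap.sum_apply, Finset.sum_eq_single 1]
  · simp
  · intro h _ hh
    simp [Pi.single_eq_of_ne hh]
  · simp

/-- The translates of U under G span the induced representation. Together with `indDesc_incl` this
gives Hom_G(Ind U, X) = Hom_K(U, X). -/
lemma ind_hom_ext {X : FDRep K G} {φ ψ : indRep K G U ⟶ X}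
    (h : lin φ ∘ₗ indIncl K G U = lin ψ ∘ₗ indIncl K G U) : φ = ψ := by
  classical
  have key (χ : indRep K G U ⟶ X) (g : G) (x : U) : lin χ (Pi.single g x : G → U) =
      X.ρ g ((lin χ ∘ₗ indIncl K G U) x) := by
    rw [← indRep_rho_incl, ← LinearMap.comp_apply, lin_rho]
    rfl
  refine lin_injective (LinearMap.pi_ext (R := K) (φ := fun _ : G => U)
    (f := (lin φ : (G → U) →ₗ[K] X)) (g := (lin ψ : (G → U) →ₗ[K] X)) fun g x => ?_)
  exact (key φ g x).trans ((congrArg (fun t => X.ρ g (t x)) h).trans (key ψ g x).symm)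

/-- The functor `X ↦ Hom(Hom_G(X, M), N)`. -/
def dualHFunctor (M : FDRep K G) (N : Type u) [AddCommGroup N] [Module K N] [Module.Finite K N] :
    RepFunctor K G :=
  mkLinFun (fun X => (X ⟶ M) →ₗ[K] N)
    (LinearMap.mk₂ K (fun g l => l ∘ₗ Linear.leftComp K M g)
      (fun g g' l => LinearMap.ext fun φ => by simp)
      (fun r g l => LinearMap.ext fun φ => by simp)
      (fun g l l' => rfl) (fun r g l => rfl))
    (fun X l => LinearMap.ext fun φ => congrArg l (Category.id_comp φ))
    (fun f g l => LinearMap.ext fun φ => congrArg l (Category.assoc f g φ))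

lemma lsum_comp_single {ι A B : Type*} [Fintype ι] [DecidableEq ι] [AddCommGroup A] [Module K A]
    [AddCommGroup B] [Module K B] (f : ι → A →ₗ[K] B) (i : ι) :
    LinearMap.lsum K (fun _ : ι => A) K f ∘ₗ LinearMap.single K (fun _ : ι => A) i = f i :=
  LinearMap.ext fun x => by
    rw [LinearMap.comp_apply, LinearMap.single_apply, LinearMap.lsum_piSingle]

/-- A family of linear maps `M → X` as a functional with values in `K ^ ι`. -/
def traceFamily {ι : Type} [DecidableEq ι] {M X : FDRep K G} (θ : (ι → M) →ₗ[K] X) :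
    (X ⟶ M) →ₗ[K] (ι → K) :=
  LinearMap.pi fun k => tracePairing K M X (θ ∘ₗ LinearMap.single K (fun _ : ι => M) k) ∘ₗ lin

omit [Fintype G] in
lemma traceFamily_apply {ι : Type} [DecidableEq ι] {M X : FDRep K G} (θ : (ι → M) →ₗ[K] X)
    (φ : X ⟶ M) (k : ι) : traceFamily θ φ k =
      tracePairing K M X (θ ∘ₗ LinearMap.single K (fun _ : ι => M) k) (lin φ) := rfl

omit [Fintype G] in
lemma traceFamily_surjective {ι : Type} [Fintype ι] [DecidableEq ι] {M X : FDRep K G}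
    (l : (X ⟶ M) →ₗ[K] (ι → K)) : ∃ θ : (ι → M) →ₗ[K] X, traceFamily θ = l := by
  choose θ hθ using fun k => exists_tracePairing (LinearMap.proj k ∘ₗ l)
  refine ⟨LinearMap.lsum K (fun _ : ι => M) K θ, LinearMap.ext fun φ => funext fun k => ?_⟩
  rw [traceFamily_apply, lsum_comp_single]
  exact (hθ k φ).symm

/-- The linear map whose composites with morphisms are the linear maps that pair to zero with
the equivariant ones. -/
def traceRel (ι : Type) [Fintype ι] [DecidableEq ι] [DecidableEq G] (M : FDRep K G) :
    (ι → M) →ₗ[K] indRep K G (ι × G → M) :=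
  LinearMap.lsum K (fun _ : ι => M) K fun k =>
    ∑ g, ((indRep K G (ι × G → M)).ρ g ∘ₗ (indIncl K G (ι × G → M) ∘ₗ
        LinearMap.single K (fun _ : ι × G => M) (k, g)) -
      (indIncl K G (ι × G → M) ∘ₗ LinearMap.single K (fun _ : ι × G => M) (k, g)) ∘ₗ M.ρ g)

lemma lin_comp_traceRel {ι : Type} [Fintype ι] [DecidableEq ι] [DecidableEq G] {M X : FDRep K G}
    (h : indRep K G (ι × G → M) ⟶ X) (k : ι) :
    lin h ∘ₗ traceRel ι M ∘ₗ LinearMap.single K (fun _ : ι => M) k =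
      ∑ g, (X.ρ g ∘ₗ ((lin h ∘ₗ indIncl K G (ι × G → M)) ∘ₗ
          LinearMap.single K (fun _ : ι × G => M) (k, g)) -
        ((lin h ∘ₗ indIncl K G (ι × G → M)) ∘ₗ
          LinearMap.single K (fun _ : ι × G => M) (k, g)) ∘ₗ M.ρ g) := by
  rw [traceRel, lsum_comp_single]
  refine (map_sum (LinearMap.llcomp K M (indRep K G (ι × G → M)) X (lin h)) _ _).trans ?_
  refine Finset.sum_congr rfl fun g _ => ?_
  change lin h ∘ₗ _ = _
  rw [LinearMap.comp_sub, ← LinearMap.comp_assoc, lin_rho]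
  rfl

/-- The witnesses η in `tracePairing_lin_eq_zero_iff`, one for each pair in ι × G, assemble into one
linear map from ι × G → M, hence into one morphism from the induced representation. This makes the
relations representable. -/
lemma traceFamily_eq_zero_iff {ι : Type} [Fintype ι] [DecidableEq ι] [DecidableEq G]
    {M X : FDRep K G} (θ : (ι → M) →ₗ[K] X) :
    traceFamily θ = 0 ↔ ∃ h : indRep K G (ι × G → M) ⟶ X, lin h ∘ₗ traceRel ι M = θ := by
  have h1 : traceFamily θ = 0 ↔ ∀ k, ∀ φ : X ⟶ M,
      tracePairing K M X (θ ∘ₗ LinearMap.single K (fun _ : ι => M) k) (lin φ) = 0 :=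
    ⟨fun h k φ => congrFun (LinearMap.congr_fun h φ) k,
      fun h => LinearMap.ext fun φ => funext fun k => h k φ⟩
  rw [h1]
  simp only [tracePairing_lin_eq_zero_iff]
  constructor
  · intro h
    choose η hη using h
    refine ⟨indDesc (LinearMap.lsum K (fun _ : ι × G => M) K fun kg => η kg.1 kg.2),
      LinearMap.pi_ext' fun k => ?_⟩
    rw [LinearMap.comp_assoc, lin_comp_traceRel, indDesc_incl, hη k]
    simp only [lsum_comp_single]
  · rintro ⟨h, rfl⟩ k
    exact ⟨_, (LinearMap.comp_assoc _ _ _).trans (lin_comp_traceRel h k)⟩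

/-- With N = K^ι, the trace gives a surjection from Hom_K(M^ι, X) = Hom_G(Ind M^ι, X). Its kernel
consists of the maps that factor through `traceRel`, so it is the image of Hom_G(Ind M^{ι × G}, X).
-/
lemma isCoherent_dualHFunctor (M : FDRep K G) (N : Type u) [AddCommGroup N] [Module K N]
    [Module.Finite K N] : IsCoherent K (dualHFunctor M N) := by
  classical
  rw [isCoherent_iff]
  let ι := Fin (Module.finrank K N)
  let e : N ≃ₗ[K] (ι → K) := (Module.finBasis K N).equivFun
  have he (X : FDRep K G) (θ : (ι → M) →ₗ[K] X) :
      e.symm.toLinearMap ∘ₗ traceFamily θ = 0 ↔ traceFamily θ = 0 := by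
    refine ⟨fun h => LinearMap.ext fun φ => e.symm.injective ?_, fun h => by
      rw [h, LinearMap.comp_zero]⟩
    exact (LinearMap.congr_fun h φ).trans (map_zero e.symm).symm
  have hact (X : FDRep K G) (g : indRep K G (ι → M) ⟶ X) :
      act (dualHFunctor M N) g (e.symm.toLinearMap ∘ₗ traceFamily (indIncl K G (ι → M))) =
        e.symm.toLinearMap ∘ₗ traceFamily (lin g ∘ₗ indIncl K G (ι → M)) := rfl
  refine ⟨indRep K G (ι → M), indRep K G (ι × G → M), indDesc (traceRel ι M),
    e.symm.toLinearMap ∘ₗ traceFamily (indIncl K G (ι → M)), fun X l => ?_, fun X g => ?_⟩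
  · obtain ⟨θ, hθ⟩ := traceFamily_surjective (e.toLinearMap ∘ₗ (show (X ⟶ M) →ₗ[K] N from l))
    refine ⟨indDesc θ, (hact X _).trans ?_⟩
    rw [indDesc_incl, hθ]
    exact LinearMap.ext fun φ => e.symm_apply_apply _
  · refine (Eq.congr_left (hact X g)).trans ((he X _).trans ?_)
    rw [traceFamily_eq_zero_iff]
    refine exists_congr fun h => ?_
    constructor
    · intro hh
      refine ind_hom_ext ?_
      rw [lin_comp, LinearMap.comp_assoc, indDesc_incl, hh]
    · rintro rfl
      rw [lin_comp, LinearMap.comp_assoc, indDesc_incl]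

end DualRepresentable

/-! ### Adjoints of restriction along a fully faithful functor -/

section Restriction

universe w w'

variable {K : Type u} [Field K] {C : Type w} [Category.{u} C] [Preadditive C] [Linear K C]
  {D : Type w'} [Category.{u} D] [Preadditive D] [Linear K D]

/-- A morphism of linear functors with bijective components is an isomorphism. -/
lemma isIso_of_bijective {F F' : LinFun K C} (φ : F ⟶ F')
    (h : ∀ X, Function.Bijective (app φ X)) : IsIso φ := by
  let e (X : C) := LinearEquiv.ofBijective (app φ X) (h X)
  refine ⟨mkHom (fun X => (e X).symm.toLinearMap) fun {X Y} g x => ?_, hom_ext fun X x => ?_,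
    hom_ext fun X x => ?_⟩
  · obtain ⟨y, rfl⟩ := (e X).surjective x
    apply (e Y).injective
    rw [LinearEquiv.coe_coe, LinearEquiv.coe_coe, LinearEquiv.apply_symm_apply,
      LinearEquiv.symm_apply_apply]
    exact (app_act φ g y).symm
  · exact (e X).symm_apply_apply x
  · exact (e X).apply_symm_apply x

/-- The object `W` generates `C`: identities are sums of morphisms that factor through `W`. -/
def IsGenerator (W : C) : Prop :=
  ∀ V : C, ∃ (ι : Type) (_ : Fintype ι) (a : ι → (V ⟶ W)) (b : ι → (W ⟶ V)),
    ∑ j, a j ≫ b j = 𝟙 V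

/-- A presentation of a linear functor by elements of its value on `W`. -/
structure Presentation (F : LinFun K C) (W : C) where
  /-- the number of generators -/
  gens : ℕ
  /-- the number of relations -/
  rels : ℕ
  /-- the generators -/
  x : Fin gens → F.obj.obj W
  /-- the relations -/
  r : Fin rels → Fin gens → (W ⟶ W)
  exists_eq : ∀ V (y : F.obj.obj V), ∃ g : Fin gens → (W ⟶ V), ∑ k, act F (g k) (x k) = y
  sum_eq_zero_iff : ∀ V (g : Fin gens → (W ⟶ V)), ∑ k, act F (g k) (x k) = 0 ↔
    ∃ h : Fin rels → (W ⟶ V), ∀ k, g k = ∑ l, r l k ≫ h l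

lemma act_eq_of_sum_eq (F : LinFun K C) {V W : C} {ι : Type} [Fintype ι] {a : ι → (V ⟶ W)}
    {b : ι → (W ⟶ V)} (hab : ∑ j, a j ≫ b j = 𝟙 V) (y : F.obj.obj V) :
    ∑ j, act F (b j) (act F (a j) y) = y := by
  simp only [← act_comp]
  rw [← act_sum, hab, act_id]

/-- Bases suffice: one of F(W) for the generators, and one of the finite-dimensional space of
relations over W. The generator property carries both from W to every other object. -/
lemma exists_presentation (F : LinFun K C) {W : C} [Module.Finite K (W ⟶ W)]
    (hW : IsGenerator W) : Nonempty (Presentation F W) := by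
  let β := Module.finBasis K (F.obj.obj W)
  let t : (Fin (Module.finrank K (F.obj.obj W)) → (W ⟶ W)) →ₗ[K] F.obj.obj W :=
    ∑ k, (act F).flip (β k) ∘ₗ LinearMap.proj k
  have ht (g) : t g = ∑ k, act F (g k) (β k) := by
    simp [t]
  let ρ := Module.finBasis K (LinearMap.ker t)
  have hρ (l) : ∑ k, act F ((ρ l).1 k) (β k) = 0 := by
    rw [← ht]
    exact (ρ l).2
  refine ⟨⟨_, _, β, fun l => (ρ l).1, fun V y => ?_, fun V g => ⟨fun h => ?_, ?_⟩⟩⟩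
  · obtain ⟨ι, _, a, b, hab⟩ := hW V
    -- Since y = ∑ b_j(a_j(y)), expand each a_j(y) ∈ F(W) in the basis and push forward along b_j.
    refine ⟨fun k => ∑ j, β.repr (act F (a j) y) k • b j, ?_⟩
    simp only [act_sum, map_smul, LinearMap.smul_apply]
    rw [Finset.sum_comm]
    conv_rhs => rw [← act_eq_of_sum_eq F hab y]
    refine Finset.sum_congr rfl fun j _ => ?_
    conv_rhs => rw [← β.sum_repr (act F (a j) y), map_sum]
    simp only [map_smul]
  · obtain ⟨ι, _, a, b, hab⟩ := hW V
    -- A relation over V becomes one over W after composition with a_j; composing with b_j and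
    -- summing recovers it.
    have hmem (j : ι) : (fun k => g k ≫ a j) ∈ LinearMap.ker t := by
      rw [LinearMap.mem_ker, ht]
      simp only [act_comp]
      rw [← map_sum, h, map_zero]
    refine ⟨fun l => ∑ j, ρ.repr ⟨_, hmem j⟩ l • b j, fun k => ?_⟩
    have h1 (j : ι) : g k ≫ a j = ∑ l, ρ.repr ⟨_, hmem j⟩ l • (ρ l).1 k := by
      have := congrFun (congrArg Subtype.val (ρ.sum_repr ⟨_, hmem j⟩)) k
      rw [Submodule.coe_sum, Finset.sum_apply] at this
      exact this.symm
    rw [← Category.comp_id (g k), ← hab, Preadditive.comp_sum]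
    simp only [Preadditive.comp_sum, ← Category.assoc, h1, Preadditive.sum_comp, Linear.smul_comp,
      Linear.comp_smul]
    exact Finset.sum_comm
  · rintro ⟨h, hh⟩
    simp only [hh, act_sum, act_comp]
    rw [Finset.sum_comm]
    refine Finset.sum_eq_zero fun l _ => ?_
    rw [← map_sum, hρ, map_zero]

/-! #### The right adjoint -/

section RightObj

variable (i : C ⥤ D) (W : C) [∀ X : D, Module.Finite K (X ⟶ i.obj W)]

/-- The maps `Hom(X, i W) → F W` that commute with the endomorphisms of `W`. -/
def endLin (F : LinFun K C) (X : D) : Submodule K ((X ⟶ i.obj W) →ₗ[K] F.obj.obj W) where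
  carrier := {l | ∀ (φ : X ⟶ i.obj W) (s : W ⟶ W), l (φ ≫ i.map s) = act F s (l φ)}
  add_mem' {l l'} hl hl' φ s := by
    rw [LinearMap.add_apply, LinearMap.add_apply, hl, hl', map_add]
  zero_mem' φ s := (map_zero (act F s)).symm
  smul_mem' r l hl φ s := by
    rw [LinearMap.smul_apply, LinearMap.smul_apply, hl, map_smul]

/-- The value on `F` of the right adjoint of restriction. -/
def coindObj (F : LinFun K C) : LinFun K D :=
  mkLinFun (fun X => endLin i W F X)
    (LinearMap.mk₂ K (fun g l => ⟨l.1 ∘ₗ Linear.leftComp K (i.obj W) g, fun φ s => by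
        change l.1 (g ≫ φ ≫ i.map s) = act F s (l.1 (g ≫ φ))
        rw [← Category.assoc, l.2]⟩)
      (fun g g' l => Subtype.ext (LinearMap.ext fun φ =>
        (congrArg l.1 (Preadditive.add_comp _ _ _ g g' φ)).trans (map_add l.1 _ _)))
      (fun r g l => Subtype.ext (LinearMap.ext fun φ =>
        (congrArg l.1 (Linear.smul_comp _ _ _ r g φ)).trans (map_smul l.1 _ _)))
      (fun g l l' => rfl) (fun r g l => rfl))
    (fun X l => Subtype.ext (LinearMap.ext fun φ => congrArg l.1 (Category.id_comp φ)))
    (fun f g l => Subtype.ext (LinearMap.ext fun φ => congrArg l.1 (Category.assoc f g φ)))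

variable {i W}

/-- The element of `Hom(Hom(X, i W), F W)` given by an element of the right adjoint. -/
def coindVal {F : LinFun K C} {X : D} :
    (coindObj i W F).obj.obj X →ₗ[K] (X ⟶ i.obj W) →ₗ[K] F.obj.obj W :=
  (endLin i W F X).subtype

lemma coindVal_injective {F : LinFun K C} {X : D} :
    Function.Injective (coindVal (i := i) (W := W) (F := F) (X := X)) :=
  Subtype.val_injective

lemma coindVal_comp {F : LinFun K C} {X : D} (l : (coindObj i W F).obj.obj X)
    (φ : X ⟶ i.obj W) (s : W ⟶ W) : coindVal l (φ ≫ i.map s) = act F s (coindVal l φ) := l.2 φ s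

end RightObj

variable (i : C ⥤ D) [i.Additive] [i.Linear K]

/-- Restriction of linear functors along a linear functor. -/
def restFunctor : LinFun K D ⥤ LinFun K C where
  obj f := ⟨i ⋙ f.obj, by
    obtain ⟨F, hF₁, hF₂⟩ := f
    exact ⟨inferInstance, inferInstance⟩⟩
  map φ := ObjectProperty.homMk (Functor.whiskerLeft i φ.hom)

variable {i}

lemma app_rest {f f' : LinFun K D} (φ : f ⟶ f') (X : C) (y : f.obj.obj (i.obj X)) :
    app ((restFunctor i).map φ) X y = app φ (i.obj X) y := rfl

variable [i.Full] [i.Faithful]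

variable (K i) in
/-- The bijection on morphisms given by a fully faithful linear functor. -/
def mapEquiv (V V' : C) : (V ⟶ V') ≃ₗ[K] (i.obj V ⟶ i.obj V') :=
  LinearEquiv.ofBijective (i.mapLinearMap K) ⟨i.map_injective, i.map_surjective⟩

lemma mapEquiv_apply {V V' : C} (g : V ⟶ V') : mapEquiv K i V V' g = i.map g := rfl

lemma mapEquiv_symm_map {V V' : C} (g : V ⟶ V') : (mapEquiv K i V V').symm (i.map g) = g :=
  (mapEquiv K i V V').symm_apply_apply g

lemma mapEquiv_symm_comp {V V' V'' : C} (g : i.obj V ⟶ i.obj V') (h : V' ⟶ V'') :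
    (mapEquiv K i V V'').symm (g ≫ i.map h) = (mapEquiv K i V V').symm g ≫ h := by
  obtain ⟨g, rfl⟩ := i.map_surjective g
  rw [← i.map_comp, mapEquiv_symm_map, mapEquiv_symm_map]

section Right

variable {W : C} [∀ X : D, Module.Finite K (X ⟶ i.obj W)]

variable (i W) in
/-- The comparison of `F` with the restriction of its image under the right adjoint. -/
def coindUnit (F : LinFun K C) : F ⟶ (restFunctor i).obj (coindObj i W F) :=
  mkHom (F' := (restFunctor i).obj (coindObj i W F))
    (fun V => LinearMap.codRestrict (endLin i W F (i.obj V))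
      ((act F).flip.compl₂ (mapEquiv K i V W).symm.toLinearMap)
      fun y φ s => by
        change act F ((mapEquiv K i V W).symm (φ ≫ i.map s)) y =
          act F s (act F ((mapEquiv K i V W).symm φ) y)
        rw [mapEquiv_symm_comp, act_comp])
    (fun {V V'} g y => coindVal_injective (LinearMap.ext fun φ => by
      obtain ⟨φ, rfl⟩ := i.map_surjective φ
      change act F ((mapEquiv K i V' W).symm (i.map φ)) (act F g y) =
        act F ((mapEquiv K i V W).symm (i.map g ≫ i.map φ)) y
      rw [← i.map_comp, mapEquiv_symm_map, mapEquiv_symm_map, act_comp]))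

lemma coindVal_unit {F : LinFun K C} {V : C} (y : F.obj.obj V) (g : V ⟶ W) :
    coindVal (app (coindUnit i W F) V y) (i.map g) = act F g y := by
  change act F ((mapEquiv K i V W).symm (i.map g)) y = _
  rw [mapEquiv_symm_map]

/-- An element y of F(V) is recovered from all its images in F(W) as ∑ b_j(a_j(y)). Conversely an
End(W)-linear l comes from y = ∑ b_j(l(a_j)), because each b_j ≫ g is an endomorphism of W. -/
lemma coindUnit_bijective (hW : IsGenerator W) (F : LinFun K C) (V : C) :
    Function.Bijective (app (coindUnit i W F) V) := by
  obtain ⟨ι, _, a, b, hab⟩ := hW V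
  refine ⟨(injective_iff_map_eq_zero _).2 fun y hy => ?_,
    fun (l : (coindObj i W F).obj.obj (i.obj V)) => ?_⟩
  · rw [← act_eq_of_sum_eq F hab y]
    refine Finset.sum_eq_zero fun j _ => ?_
    rw [← coindVal_unit (i := i) y (a j)]
    exact (congrArg (fun t : (coindObj i W F).obj.obj (i.obj V) =>
      act F (b j) (coindVal t (i.map (a j)))) hy).trans (map_zero _)
  · refine ⟨∑ j, act F (b j) (coindVal l (i.map (a j))),
      coindVal_injective (LinearMap.ext fun φ => ?_)⟩
    obtain ⟨g, rfl⟩ := i.map_surjective φ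
    rw [coindVal_unit, map_sum]
    simp only [← act_comp, ← coindVal_comp, ← i.map_comp]
    rw [← map_sum, ← i.map_sum]
    congr 2
    simp only [← Category.assoc]
    rw [← Preadditive.sum_comp, hab, Category.id_comp]

lemma isIso_coindUnit (hW : IsGenerator W) (F : LinFun K C) : IsIso (coindUnit i W F) :=
  isIso_of_bijective _ (coindUnit_bijective hW F)

lemma rest_map_bijective (hW : IsGenerator W) (f : LinFun K D) (F : LinFun K C) :
    Function.Bijective fun β : f ⟶ coindObj i W F => (restFunctor i).map β ≫
      @inv _ _ _ _ (coindUnit i W F) (isIso_coindUnit hW F) := by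
  have := isIso_coindUnit (i := i) hW F
  constructor
  · intro β β' h
    have h' := (cancel_mono _).1 h
    refine hom_ext fun X y => coindVal_injective (LinearMap.ext fun φ => ?_)
    -- By naturality along `φ`, a morphism into the coinduced functor is determined by its component
    -- at i W, evaluated at the identity.
    have key (β : f ⟶ coindObj i W F) : coindVal (app β X y) φ =
        coindVal (app ((restFunctor i).map β) W (act f φ y)) (𝟙 _) := by
      rw [app_rest, app_act]
      exact congrArg _ (Category.comp_id φ).symm
    rw [key, h', ← key]
  · intro α
    refine ⟨mkHom (F' := coindObj i W F) (fun X => LinearMap.codRestrict (endLin i W F X)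
      ((act f).flip.compr₂ (app α W)) fun y φ s => ?_) fun g y => ?_, ?_⟩
    · exact (congrArg (app α W) (act_comp f φ (i.map s) y)).trans (app_act α s (act f φ y))
    · refine coindVal_injective (LinearMap.ext fun φ => ?_)
      change app α W (act f φ (act f g y)) = app α W (act f (g ≫ φ) y)
      rw [act_comp]
    · rw [IsIso.comp_inv_eq]
      refine hom_ext fun V y => coindVal_injective (LinearMap.ext fun φ => ?_)
      obtain ⟨g, rfl⟩ := i.map_surjective φ
      rw [app_comp, coindVal_unit, ← app_act]
      rfl

/-- The universal property of the right adjoint of restriction. -/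
def coindEquiv (hW : IsGenerator W) (f : LinFun K D) (F : LinFun K C) :
    ((restFunctor i).obj f ⟶ F) ≃ (f ⟶ coindObj i W F) :=
  (Equiv.ofBijective _ (rest_map_bijective hW f F)).symm

lemma coindEquiv_symm_apply (hW : IsGenerator W) (f : LinFun K D) (F : LinFun K C)
    (β : f ⟶ coindObj i W F) : (coindEquiv hW f F).symm β = (restFunctor i).map β ≫
      @inv _ _ _ _ (coindUnit i W F) (isIso_coindUnit hW F) := rfl

lemma coindEquiv_naturality (hW : IsGenerator W) (f' f : LinFun K D) (F : LinFun K C)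
    (φ : f' ⟶ f) (g : (restFunctor i).obj f ⟶ F) :
    coindEquiv hW f' F ((restFunctor i).map φ ≫ g) = φ ≫ coindEquiv hW f F g := by
  rw [← Equiv.eq_symm_apply, coindEquiv_symm_apply, Functor.map_comp, Category.assoc,
    ← coindEquiv_symm_apply hW, Equiv.symm_apply_apply]

variable (i) in
/-- The right adjoint of restriction. -/
def coind (hW : IsGenerator W) : LinFun K C ⥤ LinFun K D :=
  Adjunction.rightAdjointOfEquiv (coindEquiv (i := i) hW) (coindEquiv_naturality hW)

/-- Restriction is left adjoint to `coind`. -/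
def coindAdjunction (hW : IsGenerator W) : restFunctor (K := K) i ⊣ coind i hW :=
  Adjunction.adjunctionOfEquivRight (coindEquiv hW) (coindEquiv_naturality hW)

/-- The adjunction bijection was built from the inverse of `coindUnit`, so its value at the
identity, the counit, is that inverse. -/
lemma isIso_coindAdjunction_counit (hW : IsGenerator W) :
    IsIso (coindAdjunction (K := K) (i := i) hW).counit := by
  refine (NatTrans.isIso_iff_isIso_app _).2 fun F => ?_
  have := isIso_coindUnit (i := i) hW F
  have h : (coindAdjunction (i := i) hW).counit.app F = inv (coindUnit i W F) := by
    rw [← Adjunction.homEquiv_symm_id]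
    refine (coindEquiv_symm_apply hW _ F (𝟙 _)).trans ?_
    rw [CategoryTheory.Functor.map_id, Category.id_comp]
  rw [h]
  exact @IsIso.inv_isIso _ _ _ _ (coindUnit i W F) this

end Right

end Restriction

section Left

universe w w'

variable {K : Type u} [Field K] {C : Type w} [Category.{u} C] [Preadditive C] [Linear K C]
  {D : Type w'} [Category.{u} D] [Preadditive D] [Linear K D]

/-! #### The left adjoint -/

section LeftObj

variable (i : C ⥤ D) {W : C} [∀ X : D, Module.Finite K (i.obj W ⟶ X)]

/-- The relations in `Hom(i W, X) ^ b` given by a presentation. -/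
def relMap {F : LinFun K C} (P : Presentation F W) (X : D) :
    (Fin P.rels → (i.obj W ⟶ X)) →ₗ[K] (Fin P.gens → (i.obj W ⟶ X)) :=
  LinearMap.pi fun k => ∑ l, Linear.leftComp K X (i.map (P.r l k)) ∘ₗ LinearMap.proj l

omit [∀ X : D, Module.Finite K (i.obj W ⟶ X)] in
lemma relMap_apply {F : LinFun K C} (P : Presentation F W) {X : D}
    (h : Fin P.rels → (i.obj W ⟶ X)) (k : Fin P.gens) :
    relMap i P X h k = ∑ l, i.map (P.r l k) ≫ h l := by
  simp [relMap]

/-- Composition of families of morphisms with a morphism. -/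
def postComp (b : ℕ) (E : D) {X Y : D} :
    (X ⟶ Y) →ₗ[K] (Fin b → (E ⟶ X)) →ₗ[K] (Fin b → (E ⟶ Y)) where
  toFun g := (Linear.rightComp K E g).compLeft (Fin b)
  map_add' g g' := LinearMap.ext fun h => funext fun k => Preadditive.comp_add _ _ _ (h k) g g'
  map_smul' r g := LinearMap.ext fun h => funext fun k => Linear.comp_smul _ _ _ (h k) r g

omit [∀ X : D, Module.Finite K (i.obj W ⟶ X)] in
lemma range_relMap_le {F : LinFun K C} (P : Presentation F W) {X Y : D} (g : X ⟶ Y) :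
    LinearMap.range (relMap i P X) ≤
      (LinearMap.range (relMap i P Y)).comap (postComp (K := K) P.gens (i.obj W) g) := by
  rintro _ ⟨h, rfl⟩
  refine ⟨fun l => h l ≫ g, funext fun k => ?_⟩
  refine (relMap_apply i P _ k).trans ?_
  change _ = relMap i P X h k ≫ g
  rw [relMap_apply, Preadditive.sum_comp]
  simp only [Category.assoc]

/-- The value on `F` of the left adjoint of restriction, given a presentation of `F`. -/
def indObj {F : LinFun K C} (P : Presentation F W) : LinFun K D :=
  mkLinFun (fun X => (Fin P.gens → (i.obj W ⟶ X)) ⧸ LinearMap.range (relMap i P X))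
    { toFun := fun g => Submodule.mapQ _ _ (postComp P.gens (i.obj W) g) (range_relMap_le i P g)
      map_add' := fun g g' => LinearMap.ext fun x => by
        obtain ⟨h, rfl⟩ := Submodule.Quotient.mk_surjective _ x
        exact congrArg Submodule.Quotient.mk (LinearMap.congr_fun
          (map_add (postComp (K := K) P.gens (i.obj W)) g g') h)
      map_smul' := fun r g => LinearMap.ext fun x => by
        obtain ⟨h, rfl⟩ := Submodule.Quotient.mk_surjective _ x
        exact congrArg Submodule.Quotient.mk (LinearMap.congr_fun
          (map_smul (postComp (K := K) P.gens (i.obj W)) r g) h) }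
    (fun X x => by
      obtain ⟨h, rfl⟩ := Submodule.Quotient.mk_surjective _ x
      exact congrArg Submodule.Quotient.mk (funext fun k => Category.comp_id (h k)))
    (fun f g x => by
      obtain ⟨h, rfl⟩ := Submodule.Quotient.mk_surjective _ x
      exact congrArg Submodule.Quotient.mk (funext fun k => (Category.assoc (h k) f g).symm))

/-- The class of a family of morphisms in the left adjoint. -/
def indMk {F : LinFun K C} (P : Presentation F W) (X : D) :
    (Fin P.gens → (i.obj W ⟶ X)) →ₗ[K] (indObj i P).obj.obj X :=
  (LinearMap.range (relMap i P X)).mkQ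

lemma indMk_surjective {F : LinFun K C} (P : Presentation F W) (X : D) :
    Function.Surjective (indMk i P X) := Submodule.mkQ_surjective _

lemma indMk_eq_zero_iff {F : LinFun K C} (P : Presentation F W) (X : D)
    (g : Fin P.gens → (i.obj W ⟶ X)) : indMk i P X g = 0 ↔
      ∃ h : Fin P.rels → (i.obj W ⟶ X), ∀ k, ∑ l, i.map (P.r l k) ≫ h l = g k := by
  refine (Submodule.Quotient.mk_eq_zero _).trans (exists_congr fun h => ?_)
  rw [funext_iff]
  simp only [relMap_apply]

lemma act_indMk {F : LinFun K C} (P : Presentation F W) {X Y : D} (f : X ⟶ Y)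
    (g : Fin P.gens → (i.obj W ⟶ X)) :
    act (indObj i P) f (indMk i P X g) = indMk i P Y fun k => g k ≫ f := rfl

/-- A linear map out of the left adjoint from a linear map that kills the relations. -/
def indLift {F : LinFun K C} (P : Presentation F W) {X : D} {N : Type*} [AddCommGroup N]
    [Module K N] (t : (Fin P.gens → (i.obj W ⟶ X)) →ₗ[K] N)
    (ht : ∀ h, t (relMap i P X h) = 0) : (indObj i P).obj.obj X →ₗ[K] N :=
  (LinearMap.range (relMap i P X)).liftQ t (by
    rintro _ ⟨h, rfl⟩
    exact ht h)

lemma indLift_mk {F : LinFun K C} (P : Presentation F W) {X : D} {N : Type*} [AddCommGroup N]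
    [Module K N] (t : (Fin P.gens → (i.obj W ⟶ X)) →ₗ[K] N)
    (ht : ∀ h, t (relMap i P X h) = 0) (g) : indLift i P t ht (indMk i P X g) = t g := rfl

/-- Hence a morphism out of `indObj` is determined by its values on finitely many classes over i W.
-/
lemma indMk_eq_sum {F : LinFun K C} (P : Presentation F W) (X : D)
    (g : Fin P.gens → (i.obj W ⟶ X)) :
    indMk i P X g = ∑ k, act (indObj i P) (g k) (indMk i P (i.obj W) (Pi.single k (𝟙 _))) := by
  simp only [act_indMk]
  rw [← map_sum]
  congr 1
  funext k
  rw [Finset.sum_apply, Finset.sum_eq_single k]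
  · rw [Pi.single_eq_same, Category.id_comp]
  · intro j _ hj
    rw [Pi.single_eq_of_ne hj.symm, Limits.zero_comp]
  · simp

/-- The map `Hom(i W, X) ^ b → f X` given by elements of `f (i W)`. -/
def evalFamily {b : ℕ} {E : D} (f : LinFun K D) (y : Fin b → f.obj.obj E) (X : D) :
    (Fin b → (E ⟶ X)) →ₗ[K] f.obj.obj X :=
  ∑ k, (act f).flip (y k) ∘ₗ LinearMap.proj k

lemma evalFamily_apply {b : ℕ} {E : D} (f : LinFun K D) (y : Fin b → f.obj.obj E) (X : D)
    (g : Fin b → (E ⟶ X)) : evalFamily f y X g = ∑ k, act f (g k) (y k) := by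
  simp [evalFamily]

omit [∀ X : D, Module.Finite K (i.obj W ⟶ X)] in
lemma evalFamily_relMap {F : LinFun K C} (P : Presentation F W) (f : LinFun K D)
    (y : Fin P.gens → f.obj.obj (i.obj W))
    (hy : ∀ l, ∑ k, act f (i.map (P.r l k)) (y k) = 0) (X : D) (h) :
    evalFamily f y X (relMap i P X h) = 0 := by
  rw [evalFamily_apply]
  simp only [relMap_apply, act_sum, act_comp]
  rw [Finset.sum_comm]
  refine Finset.sum_eq_zero fun l _ => ?_
  rw [← map_sum, hy, map_zero]

/-- The morphism out of the left adjoint given by elements that satisfy the relations. -/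
def indDescHom {F : LinFun K C} (P : Presentation F W) (f : LinFun K D)
    (y : Fin P.gens → f.obj.obj (i.obj W))
    (hy : ∀ l, ∑ k, act f (i.map (P.r l k)) (y k) = 0) : indObj i P ⟶ f :=
  mkHom (F := indObj i P)
    (fun X => indLift i P (evalFamily f y X) (evalFamily_relMap i P f y hy X))
    (fun {X Y} g x => by
      obtain ⟨h, rfl⟩ := indMk_surjective i P X x
      rw [act_indMk, indLift_mk, indLift_mk, evalFamily_apply, evalFamily_apply, map_sum]
      simp only [act_comp])

lemma app_indDescHom {F : LinFun K C} (P : Presentation F W) (f : LinFun K D)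
    (y : Fin P.gens → f.obj.obj (i.obj W))
    (hy : ∀ l, ∑ k, act f (i.map (P.r l k)) (y k) = 0) (X : D)
    (g : Fin P.gens → (i.obj W ⟶ X)) :
    app (indDescHom i P f y hy) X (indMk i P X g) = ∑ k, act f (g k) (y k) :=
  evalFamily_apply f y X g

end LeftObj

lemma Presentation.rel_eq_zero {F : LinFun K C} {W : C} (P : Presentation F W)
    (l : Fin P.rels) : ∑ k, act F (P.r l k) (P.x k) = 0 := by
  refine (P.sum_eq_zero_iff W (P.r l)).2 ⟨Pi.single l (𝟙 W), fun k => ?_⟩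
  rw [Finset.sum_eq_single l]
  · rw [Pi.single_eq_same, Category.comp_id]
  · intro j _ hj
    rw [Pi.single_eq_of_ne hj, Limits.comp_zero]
  · simp

variable {i : C ⥤ D} [i.Additive] [i.Linear K] [i.Full] [i.Faithful]
  {W : C} [∀ X : D, Module.Finite K (i.obj W ⟶ X)]

variable (i) in
/-- The comparison of the restriction of the image of `F` under the left adjoint with `F`. -/
def indCounit {F : LinFun K C} (P : Presentation F W) :
    (restFunctor i).obj (indObj i P) ⟶ F :=
  mkHom (F := (restFunctor i).obj (indObj i P))
    (fun V => indLift i P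
      (evalFamily F P.x V ∘ₗ (mapEquiv K i W V).symm.toLinearMap.compLeft _) fun h => by
        rw [LinearMap.comp_apply, evalFamily_apply, P.sum_eq_zero_iff]
        refine ⟨fun l => (mapEquiv K i W V).symm (h l), fun k => ?_⟩
        apply (mapEquiv K i W V).injective
        rw [map_sum]
        refine ((mapEquiv K i W V).apply_symm_apply _).trans ((relMap_apply i P h k).trans ?_)
        refine Finset.sum_congr rfl fun l _ => ?_
        rw [mapEquiv_apply, i.map_comp, ← mapEquiv_apply (K := K) ((mapEquiv K i W V).symm (h l)),
          LinearEquiv.apply_symm_apply])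
    (fun {V V'} g x => by
      obtain ⟨h, rfl⟩ := indMk_surjective i P (i.obj V) x
      refine (evalFamily_apply F P.x V' _).trans (Eq.trans ?_
        (congrArg (act F g) (evalFamily_apply F P.x V _).symm))
      rw [map_sum]
      refine Finset.sum_congr rfl fun k _ => ?_
      rw [← act_comp]
      congr 2
      exact mapEquiv_symm_comp (K := K) (h k) g)

lemma app_indCounit {F : LinFun K C} (P : Presentation F W) {V : C}
    (g : Fin P.gens → (W ⟶ V)) :
    app (indCounit i P) V (indMk i P (i.obj V) fun k => i.map (g k)) =
      ∑ k, act F (g k) (P.x k) := by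
  refine (evalFamily_apply F P.x V _).trans (Finset.sum_congr rfl fun k _ => ?_)
  congr 2
  exact mapEquiv_symm_map (K := K) (g k)

omit [i.Additive] [i.Linear K] [i.Faithful] in
lemma exists_indMk_map {F : LinFun K C} (P : Presentation F W) {V : C}
    (x : (indObj i P).obj.obj (i.obj V)) :
    ∃ g : Fin P.gens → (W ⟶ V), indMk i P (i.obj V) (fun k => i.map (g k)) = x := by
  obtain ⟨h, rfl⟩ := indMk_surjective i P (i.obj V) x
  choose g hg using fun k => i.map_surjective (h k)
  exact ⟨g, congrArg _ (funext hg)⟩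

/-- At i V full faithfulness turns the cokernel defining `indObj` into the cokernel presenting F(V).
-/
lemma isIso_indCounit {F : LinFun K C} (P : Presentation F W) : IsIso (indCounit i P) := by
  refine isIso_of_bijective _ fun V => ⟨(injective_iff_map_eq_zero _).2 fun x hx => ?_,
    fun y => ?_⟩
  · obtain ⟨g, rfl⟩ := exists_indMk_map P x
    obtain ⟨h, hh⟩ := (P.sum_eq_zero_iff V g).1 ((app_indCounit P g).symm.trans hx)
    refine (indMk_eq_zero_iff i P _ _).2 ⟨fun l => i.map (h l), fun k => ?_⟩
    rw [hh, i.map_sum]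
    simp only [i.map_comp]
  · obtain ⟨g, rfl⟩ := P.exists_eq V y
    exact ⟨_, app_indCounit P g⟩

lemma inv_rest_map_bijective {F : LinFun K C} (P : Presentation F W) (f : LinFun K D) :
    Function.Bijective fun β : indObj i P ⟶ f =>
      @inv _ _ _ _ (indCounit i P) (isIso_indCounit P) ≫ (restFunctor i).map β := by
  have := isIso_indCounit (i := i) P
  constructor
  · intro β β' h
    have h' := (cancel_epi _).1 h
    refine hom_ext fun X x => ?_
    obtain ⟨g, rfl⟩ := indMk_surjective i P X x
    rw [indMk_eq_sum, map_sum, map_sum]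
    refine Finset.sum_congr rfl fun k _ => ?_
    rw [app_act, app_act, ← app_rest, h', app_rest]
  · intro α
    have hy (l : Fin P.rels) : ∑ k, act f (i.map (P.r l k)) (app α W (P.x k)) = 0 := by
      have h := congrArg (app α W) (P.rel_eq_zero l)
      rw [map_sum, map_zero] at h
      refine Eq.trans (Finset.sum_congr rfl fun k _ => ?_) h
      exact (app_act α (P.r l k) (P.x k)).symm
    -- The generators must go to their images under `α`, and these satisfy the relations because `α`
    -- is natural.
    refine ⟨indDescHom i P f (fun k => app α W (P.x k)) hy, ?_⟩
    rw [IsIso.inv_comp_eq]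
    refine hom_ext fun V x => ?_
    obtain ⟨g, rfl⟩ := exists_indMk_map P x
    refine Eq.trans ?_ (congrArg (app α V) (app_indCounit P g)).symm
    rw [map_sum]
    refine (app_indDescHom i P f _ hy _ _).trans (Finset.sum_congr rfl fun k _ => ?_)
    exact (app_act α (g k) (P.x k)).symm

/-- The universal property of the left adjoint of restriction. -/
def indEquiv {F : LinFun K C} (P : Presentation F W) (f : LinFun K D) :
    (indObj i P ⟶ f) ≃ (F ⟶ (restFunctor i).obj f) :=
  Equiv.ofBijective _ (inv_rest_map_bijective P f)

lemma indEquiv_apply {F : LinFun K C} (P : Presentation F W) (f : LinFun K D)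
    (β : indObj i P ⟶ f) : indEquiv P f β =
      @inv _ _ _ _ (indCounit i P) (isIso_indCounit P) ≫ (restFunctor i).map β := rfl

lemma indEquiv_naturality {F : LinFun K C} (P : Presentation F W) (f f' : LinFun K D)
    (φ : f ⟶ f') (β : indObj i P ⟶ f) :
    indEquiv P f' (β ≫ φ) = indEquiv P f β ≫ (restFunctor i).map φ := by
  rw [indEquiv_apply, indEquiv_apply, Functor.map_comp, Category.assoc]

variable (i) in
/-- The left adjoint of restriction. -/
def ind (P : ∀ F : LinFun K C, Presentation F W) : LinFun K C ⥤ LinFun K D :=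
  Adjunction.leftAdjointOfEquiv (fun F f => indEquiv (i := i) (P F) f)
    fun F => indEquiv_naturality (P F)

/-- Restriction is right adjoint to `ind`. -/
def indAdjunction (P : ∀ F : LinFun K C, Presentation F W) :
    ind i P ⊣ restFunctor (K := K) i :=
  Adjunction.adjunctionOfEquivLeft (fun F f => indEquiv (i := i) (P F) f)
    fun F => indEquiv_naturality (P F)

lemma isIso_indAdjunction_unit (P : ∀ F : LinFun K C, Presentation F W) :
    IsIso (indAdjunction (i := i) P).unit := by
  refine (NatTrans.isIso_iff_isIso_app _).2 fun F => ?_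
  have := isIso_indCounit (i := i) (P F)
  have h : (indAdjunction (i := i) P).unit.app F = inv (indCounit i (P F)) := by
    rw [← Adjunction.homEquiv_id]
    refine (indEquiv_apply (P F) _ (𝟙 _)).trans ?_
    rw [CategoryTheory.Functor.map_id, Category.comp_id]
  rw [h]
  exact @IsIso.inv_isIso _ _ _ _ (indCounit i (P F)) this

end Left

/-! #### Coherence -/

section AdjointCoherent

universe w

variable {K : Type u} [Field K] {C : Type w} [Category.{u} C] [Preadditive C] [Linear K C]
  {G : Type} [Group G] (i : C ⥤ FDRep K G) {W : C}

/-- A finite power of Hom(iW, X) is represented by a coproduct of copies of iW, so the defining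
cokernel is a cokernel of representables. -/
lemma isCoherent_indObj {F : LinFun K C} (P : Presentation F W) :
    IsCoherent K (indObj i P) := by
  rw [isCoherent_iff]
  refine ⟨∐ fun _ : Fin P.gens => i.obj W, ∐ fun _ : Fin P.rels => i.obj W,
    Limits.Sigma.desc fun k => ∑ l, i.map (P.r l k) ≫ Limits.Sigma.ι (fun _ => i.obj W) l,
    indMk i P _ fun k => Limits.Sigma.ι (fun _ => i.obj W) k, fun X y => ?_, fun X g => ?_⟩
  · obtain ⟨h, rfl⟩ := indMk_surjective i P X y
    refine ⟨Limits.Sigma.desc h, ?_⟩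
    rw [act_indMk]
    simp only [Limits.Sigma.ι_desc]
  · rw [act_indMk, indMk_eq_zero_iff]
    constructor
    · rintro ⟨h, hh⟩
      refine ⟨Limits.Sigma.desc h, Limits.Sigma.hom_ext _ _ fun k => ?_⟩
      rw [← hh, Limits.Sigma.ι_desc_assoc, Preadditive.sum_comp]
      simp only [Category.assoc, Limits.Sigma.ι_desc]
    · rintro ⟨h, rfl⟩
      refine ⟨fun l => Limits.Sigma.ι (fun _ => i.obj W) l ≫ h, fun k => ?_⟩
      rw [Limits.Sigma.ι_desc_assoc, Preadditive.sum_comp]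
      simp only [Category.assoc]

variable [Module.Finite K (W ⟶ W)] [i.Additive] [i.Linear K]

/-- Precomposition of morphisms to `i W` with endomorphisms of `W`. -/
def compEnd (W : C) (X : FDRep K G) : (X ⟶ i.obj W) →ₗ[K] (W ⟶ W) →ₗ[K] (X ⟶ i.obj W) :=
  (Linear.comp X (i.obj W) (i.obj W)).compl₂ (i.mapLinearMap K)

/-- The defect of commutation with the endomorphisms of `W` at an object. -/
def endDefectMap (F : LinFun K C) (W : C) (X : FDRep K G) :
    ((X ⟶ i.obj W) →ₗ[K] F.obj.obj W) →ₗ[K] (X ⟶ i.obj W) →ₗ[K] (W ⟶ W) →ₗ[K] F.obj.obj W where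
  toFun l := (compEnd i W X).compr₂ l - (act F).flip ∘ₗ l
  map_add' l l' := by
    ext φ s
    simp
    abel
  map_smul' r l := by
    ext φ s
    simp [smul_sub]

/-- The defect of commutation with the endomorphisms of `W`. -/
def endDefect (F : LinFun K C) (W : C) [Module.Finite K (W ⟶ W)] :
    dualHFunctor (i.obj W) (F.obj.obj W) ⟶
      dualHFunctor (i.obj W) ((W ⟶ W) →ₗ[K] F.obj.obj W) :=
  mkHom (F := dualHFunctor (i.obj W) (F.obj.obj W))
    (F' := dualHFunctor (i.obj W) ((W ⟶ W) →ₗ[K] F.obj.obj W))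
    (endDefectMap i F W)
    (fun {X _} g l => LinearMap.ext fun φ => LinearMap.ext fun s =>
      congrArg (fun t => (show (X ⟶ i.obj W) →ₗ[K] F.obj.obj W from l) t -
        act F s ((show (X ⟶ i.obj W) →ₗ[K] F.obj.obj W from l) (g ≫ φ)))
        (Category.assoc g φ (i.map s)).symm)

/-- End(W)-linearity is the vanishing of `endDefect`, a morphism between two functors of the type
treated in `isCoherent_dualHFunctor`. -/
lemma isCoherent_coindObj [Fintype G] (F : LinFun K C) : IsCoherent K (coindObj i W F) := by
  refine (isCoherent_dualHFunctor (i.obj W) (F.obj.obj W)).of_kernel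
    (isCoherent_dualHFunctor (i.obj W) ((W ⟶ W) →ₗ[K] F.obj.obj W))
    (mkHom (F := coindObj i W F) (F' := dualHFunctor (i.obj W) (F.obj.obj W))
      (fun X => coindVal) fun g l => rfl) (endDefect i F W) (fun X => coindVal_injective)
    fun X l => ⟨fun h => ?_, ?_⟩
  · refine ⟨(⟨l, fun φ s => ?_⟩ : endLin i W F X), rfl⟩
    exact sub_eq_zero.1 (LinearMap.congr_fun (LinearMap.congr_fun h φ) s)
  · rintro ⟨l, rfl⟩
    refine LinearMap.ext fun φ => LinearMap.ext fun s => sub_eq_zero.2 ?_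
    exact coindVal_comp l φ s

end AdjointCoherent

/-! ### Full faithfulness of `V ↦ V ^ ⊗ n` -/

section FullyFaithful

variable {K : Type u} [Field K] {n : ℕ} {A B : Type u} [AddCommGroup A] [Module K A]
  [Module.Finite K A] [AddCommGroup B] [Module K B] [Module.Finite K B]

/-- The linear map with `e_j ↦ f` and `e_k ↦ 0` for `k ≠ j`. -/
def elemMap {ι : Type*} {M : Type*} [AddCommGroup M] [Module K M] (a : Module.Basis ι K M)
    (j : ι) (y : B) : M →ₗ[K] B := (a.coord j).smulRight y

omit [Module.Finite K B] in
lemma elemMap_apply {ι : Type*} [DecidableEq ι] {M : Type*} [AddCommGroup M] [Module K M]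
    (a : Module.Basis ι K M) (j k : ι) (y : B) :
    elemMap a j y (a k) = if k = j then y else 0 := by
  rw [elemMap, LinearMap.smulRight_apply, Module.Basis.coord_apply, Module.Basis.repr_self,
    Finsupp.single_apply, ite_smul, one_smul, zero_smul]

-- Tensor products of elementary maps are elementary maps for the tensor basis; this yields
-- surjectivity in `piTensorHomMap_bijective`, and injectivity follows by comparing dimensions.
omit [Module.Finite K A] [Module.Finite K B] in
lemma piTensorHomMap_tprod_elemMap {ι : Type*} (a : Module.Basis ι K A)
    (j : Fin n → ι) (y : Fin n → B) :
    PiTensorProduct.piTensorHomMap (PiTensorProduct.tprod K fun k => elemMap a (j k) (y k)) =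
      elemMap (Basis.piTensorProduct fun _ : Fin n => a) j (PiTensorProduct.tprod K y) := by
  classical
  refine (Basis.piTensorProduct fun _ : Fin n => a).ext fun q => ?_
  rw [elemMap_apply, Basis.piTensorProduct_apply, PiTensorProduct.piTensorHomMap_tprod_tprod]
  simp only [elemMap_apply]
  split_ifs with h
  · subst h
    simp
  · obtain ⟨k, hk⟩ := Function.ne_iff.1 h
    exact (PiTensorProduct.tprod K).map_coord_zero k (if_neg hk)

variable (K n A B) in
lemma piTensorHomMap_bijective :
    Function.Bijective (PiTensorProduct.piTensorHomMap (R := K) (ι := Fin n) (s := fun _ => A)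
      (t := fun _ => B)) := by
  have hs : Function.Surjective (PiTensorProduct.piTensorHomMap (R := K) (ι := Fin n)
      (s := fun _ => A) (t := fun _ => B)) := by
    rw [← LinearMap.range_eq_top, eq_top_iff]
    intro φ _
    let a := Module.finBasis K A
    let b := Module.finBasis K B
    have hφ : φ = ∑ q, ∑ r, (Basis.piTensorProduct fun _ : Fin n => b).repr
        (φ (Basis.piTensorProduct (fun _ : Fin n => a) q)) r •
          elemMap (Basis.piTensorProduct fun _ : Fin n => a) q
            (Basis.piTensorProduct (fun _ : Fin n => b) r) := by
      refine (Basis.piTensorProduct fun _ : Fin n => a).ext fun q => ?_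
      simp only [LinearMap.sum_apply, LinearMap.smul_apply]
      rw [Finset.sum_eq_single q]
      · simp only [elemMap_apply, if_true]
        exact (Module.Basis.sum_repr _ _).symm
      · intro q' _ hq
        simp only [elemMap_apply, if_neg hq.symm, smul_zero, Finset.sum_const_zero]
      · simp
    rw [hφ]
    refine Submodule.sum_mem _ fun q _ => Submodule.sum_mem _ fun r _ =>
      Submodule.smul_mem _ _ ⟨PiTensorProduct.tprod K fun k => elemMap a (q k) (b (r k)), ?_⟩
    rw [piTensorHomMap_tprod_elemMap, Basis.piTensorProduct_apply]
  refine ⟨(LinearMap.injective_iff_surjective_of_finrank_eq_finrank ?_).2 hs, hs⟩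
  simp only [Module.finrank_linearMap, Module.finrank_eq_card_basis
    (Basis.piTensorProduct fun _ : Fin n => Module.finBasis K A), Module.finrank_eq_card_basis
    (Basis.piTensorProduct fun _ : Fin n => Module.finBasis K B), Module.finrank_eq_card_basis
    (Basis.piTensorProduct fun _ : Fin n => Module.finBasis K (A →ₗ[K] B))]
  simp [mul_pow]

lemma mem_divPow_of_equivariant (t : ⨂[K] _ : Fin n, (A →ₗ[K] B))
    (ht : ∀ σ, PiTensorProduct.piTensorHomMap t ∘ₗ permRep K n A σ =
      permRep K n B σ ∘ₗ PiTensorProduct.piTensorHomMap t) : t ∈ divPow K n (A →ₗ[K] B) := by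
  intro σ
  refine (piTensorHomMap_bijective K n A B).1 (LinearMap.ext fun x => ?_)
  -- Since σ(t(y)) = (σt)(σy), taking y = σ⁻¹x shows that t and σt act alike on `x`; injectivity
  -- then gives σt = t.
  have h := LinearMap.congr_fun (ht σ) (permRep K n A σ⁻¹ x)
  simp only [LinearMap.comp_apply] at h
  rw [permRep_piTensorHomMap] at h
  have hx : permRep K n A σ (permRep K n A σ⁻¹ x) = x := by
    rw [← Module.End.mul_apply, ← map_mul, mul_inv_cancel, map_one, Module.End.one_apply]
  rw [hx] at h
  exact h.symm

end FullyFaithful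

section

variable (K : Type u) [Field K] (n : ℕ)

instance : (iFunctor K n).Faithful where
  map_injective {V W} _ _ h := Subtype.ext
    ((piTensorHomMap_bijective K n V.space W.space).1 (congrArg (fun φ => lin φ) h))

instance : (iFunctor K n).Full where
  map_surjective {V W} φ := by
    obtain ⟨t, ht⟩ := (piTensorHomMap_bijective K n V.space W.space).2 (lin φ)
    refine ⟨(⟨t, mem_divPow_of_equivariant t fun σ => ?_⟩ : divPow K n _), lin_injective ht⟩
    rw [ht]
    exact lin_rho φ σ

end

/-! ### The generator of `Γⁿ𝒱` -/

section Generator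

variable {K : Type u} [Field K] {n : ℕ}

open Classical in
/-- The sum of the tensors `f_{w 1} ⊗ ⋯ ⊗ f_{w n}` over the words `w` with the set of letters
`R`. -/
def wordSum {d : ℕ} {X : Type u} [AddCommGroup X] [Module K X] (f : Fin d → X)
    (R : Finset (Fin d)) : divPow K n X :=
  ⟨∑ w : Fin n → Fin d with Finset.univ.image w = R, PiTensorProduct.tprod K fun k => f (w k),
    fun σ => by
      rw [map_sum]
      simp only [permRep_tprod]
      refine Finset.sum_equiv (Equiv.arrowCongr σ (Equiv.refl _)) (fun w => ?_) fun w _ => rfl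
      have : Finset.univ.image (Equiv.arrowCongr σ (Equiv.refl (Fin d)) w) =
          Finset.univ.image w := by
        ext r
        simp only [Finset.mem_image, Finset.mem_univ, true_and]
        exact σ.symm.surjective.exists (p := fun k => w k = r) |>.symm
      simp only [Finset.mem_filter, Finset.mem_univ, true_and, this]⟩

open Classical in
lemma coe_wordSum {d : ℕ} {X : Type u} [AddCommGroup X] [Module K X] (f : Fin d → X)
    (R : Finset (Fin d)) : (wordSum (K := K) (n := n) f R).1 =
      ∑ w : Fin n → Fin d with Finset.univ.image w = R, PiTensorProduct.tprod K fun k => f (w k) :=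
  rfl

/-- Expand (∑ f_j)^{⊗n} over all words and group them by their set of letters, which is unchanged by
permuting positions. -/
lemma sum_wordSum {d : ℕ} {X : Type u} [AddCommGroup X] [Module K X] (f : Fin d → X) :
    ∑ R, wordSum (n := n) (K := K) f R = gammaPow n (∑ j, f j) := by
  classical
  refine Subtype.ext ?_
  rw [Submodule.coe_sum]
  simp only [coe_wordSum]
  rw [Finset.sum_fiberwise_of_maps_to (fun _ _ => Finset.mem_univ _)]
  exact ((PiTensorProduct.tprod K).map_sum fun (_ : Fin n) j => f j).symm

/-- A word of length n has at most n distinct letters, so n basis vectors of W suffice to record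
those in R: a sends v_j to e_{s(j)} for a section s of one word w with letter set R, and b = γ(e_k ↦
v_{w(k)}) undoes this on every word with letters in R. -/
lemma exists_factor_wordSum (hn : 0 < n) {V W : Type u} [AddCommGroup V] [Module K V]
    [AddCommGroup W] [Module K W] {d : ℕ} (v : Module.Basis (Fin d) K V)
    (e : Module.Basis (Fin n) K W) (R : Finset (Fin d)) :
    ∃ (a : divPow K n (V →ₗ[K] W)) (b : divPow K n (W →ₗ[K] V)),
      gammaComp b a = wordSum (fun j => elemMap v j (v j)) R := by
  classical
  by_cases hR : ∃ w : Fin n → Fin d, Finset.univ.image w = R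
  · obtain ⟨w, rfl⟩ := hR
    have hs (j : Fin d) : ∃ k : Fin n, j ∈ Finset.univ.image w → w k = j := by
      by_cases hj : j ∈ Finset.univ.image w
      · obtain ⟨k, _, hk⟩ := Finset.mem_image.1 hj
        exact ⟨k, fun _ => hk⟩
      -- Arbitrary position for a letter outside R; such letters occur in no word of the sum.
      · exact ⟨⟨0, hn⟩, fun h => absurd h hj⟩
    choose s hs using hs
    refine ⟨wordSum (fun j => elemMap v j (e (s j))) (Finset.univ.image w),
      gammaPow n (e.constr K fun k => v (w k)), Subtype.ext ?_⟩
    change tensorMap₂ n (compMap K V W V) (PiTensorProduct.tprod K fun _ => _) _ = _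
    rw [coe_wordSum, coe_wordSum, map_sum]
    refine Finset.sum_congr rfl fun q hq => ?_
    rw [tensorMap₂_tprod]
    congr 1
    funext k
    have hk : w (s (q k)) = q k := by
      refine hs _ ?_
      rw [← (Finset.mem_filter.1 hq).2]
      exact Finset.mem_image_of_mem _ (Finset.mem_univ k)
    refine LinearMap.ext fun x => ?_
    change e.constr K (fun k => v (w k)) (v.coord (q k) x • e (s (q k))) =
      v.coord (q k) x • v (q k)
    rw [map_smul, Module.Basis.constr_basis, hk]
  -- No word has letter set R, for instance when R has more than n elements, so the sum is empty.
  · refine ⟨0, 0, Subtype.ext ?_⟩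
    rw [coe_wordSum, Finset.filter_false_of_mem fun w _ h => hR ⟨w, h⟩, Finset.sum_empty]
    exact map_zero _

variable (K n) in
/-- The object `K ^ n` of `Γⁿ𝒱`. -/
def stdObj : GammaCat K n := ⟨FGModuleCat.of K (Fin n → K)⟩

/-- The identity of V is γ of a sum of rank one idempotents; it splits over letter sets R, and each
part factors through K^n. -/
lemma isGenerator_stdObj (hn : 0 < n) : IsGenerator (stdObj K n) := by
  intro V
  let v := Module.finBasis K V.space
  choose a b hab using exists_factor_wordSum hn v (Pi.basisFun K (Fin n))
  refine ⟨Finset (Fin (Module.finrank K V.space)), inferInstance, a, b, ?_⟩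
  refine (Finset.sum_congr rfl fun R _ => hab R).trans ((sum_wordSum _).trans ?_)
  have : ∑ j, elemMap v j (v j) = LinearMap.id :=
    LinearMap.ext fun x => by
      rw [LinearMap.sum_apply]
      exact v.sum_repr x
  rw [this]
  rfl

end Generator

/-! ### The adjoints of `j^*` -/

section

variable (K : Type u) [Field K] (n : ℕ)

instance (V W : GammaCat K n) : Module.Finite K (V ⟶ W) :=
  inferInstanceAs (Module.Finite K (divPow K n (V.space →ₗ[K] W.space)))

/-- The chosen presentation of a strict polynomial functor. -/
def stdPresentation (hn : 0 < n) (F : StrictPolyFunctor K n) : Presentation F (stdObj K n) :=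
  (exists_presentation F (isGenerator_stdObj hn)).some

/-- The functor `j_*`. -/
def jLowStar (hn : 0 < n) : StrictPolyFunctor K n ⥤ RepFunctor K (Equiv.Perm (Fin n)) :=
  coind (iFunctor K n) (isGenerator_stdObj hn)

/-- The functor `j_!`. -/
def jShriek (hn : 0 < n) : StrictPolyFunctor K n ⥤ RepFunctor K (Equiv.Perm (Fin n)) :=
  ind (iFunctor K n) (stdPresentation K n hn)

/-- `j_*` is right adjoint to `j^*`. -/
def jLowStarAdjunction (hn : 0 < n) : jStar K n ⊣ jLowStar K n hn :=
  -- Restriction along `iFunctor` is `jStar` by definition.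
  coindAdjunction (isGenerator_stdObj hn)

/-- `j_!` is left adjoint to `j^*`. -/
def jShriekAdjunction (hn : 0 < n) : jShriek K n hn ⊣ jStar K n :=
  indAdjunction (stdPresentation K n hn)

end

end StrictPoly

end

theorem mainTheorem6 (p : ℕ) [Fact p.Prime] (K : Type u) [Field K] [CharP K p]
    (n : ℕ) (hn : 0 < n) :
    -- both adjoints of `j^*` exist
    (∃ jLow : StrictPoly.StrictPolyFunctor K n ⥤ StrictPoly.RepFunctor K (Equiv.Perm (Fin n)),
      Nonempty (StrictPoly.jStar K n ⊣ jLow)) ∧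
    (∃ jShriek : StrictPoly.StrictPolyFunctor K n ⥤ StrictPoly.RepFunctor K (Equiv.Perm (Fin n)),
      Nonempty (jShriek ⊣ StrictPoly.jStar K n)) ∧
    -- the right adjoint `j_*`
    (∀ (jLow : StrictPoly.StrictPolyFunctor K n ⥤ StrictPoly.RepFunctor K (Equiv.Perm (Fin n)))
      (adj : StrictPoly.jStar K n ⊣ jLow),
      (∀ F, StrictPoly.IsCoherent K (jLow.obj F)) ∧ IsIso adj.counit ∧
        jLow.Full ∧ jLow.Faithful) ∧
    -- the left adjoint `j_!`
    (∀ (jShriek : StrictPoly.StrictPolyFunctor K n ⥤ StrictPoly.RepFunctor K (Equiv.Perm (Fin n)))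
      (adj : jShriek ⊣ StrictPoly.jStar K n),
      (∀ F, StrictPoly.IsCoherent K (jShriek.obj F)) ∧ IsIso adj.unit ∧
        jShriek.Full ∧ jShriek.Faithful) := by
  refine ⟨⟨_, ⟨StrictPoly.jLowStarAdjunction K n hn⟩⟩, ⟨_, ⟨StrictPoly.jShriekAdjunction K n hn⟩⟩,
    fun jLow adj => ?_, fun jShriek adj => ?_⟩
  · let adj₀ := StrictPoly.jLowStarAdjunction K n hn
    -- Adjoints are unique up to isomorphism, and coherence and full faithfulness pass along `e`. A
    -- fully faithful right adjoint has an invertible counit for the given adjunction.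
    let e := adj₀.rightAdjointUniq adj
    have : IsIso adj₀.counit :=
      StrictPoly.isIso_coindAdjunction_counit (StrictPoly.isGenerator_stdObj hn)
    have hf := adj₀.fullyFaithfulROfIsIsoCounit.ofIso e
    have := hf.full
    have := hf.faithful
    exact ⟨fun F => (StrictPoly.isCoherent_coindObj _ F).of_iso (e.app F), inferInstance,
      hf.full, hf.faithful⟩
  · let adj₀ := StrictPoly.jShriekAdjunction K n hn
    let e := adj₀.leftAdjointUniq adj
    have : IsIso adj₀.unit :=
      StrictPoly.isIso_indAdjunction_unit (StrictPoly.stdPresentation K n hn)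
    have hf := adj₀.fullyFaithfulLOfIsIsoUnit.ofIso e
    have := hf.full
    have := hf.faithful
    exact ⟨fun F => (StrictPoly.isCoherent_indObj _
      (StrictPoly.stdPresentation K n hn F)).of_iso (e.app F), inferInstance,
      hf.full, hf.faithful⟩
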